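/- For a finite nonempty alphabet $\Sigma$ and $C \in \{\mathrm{PSPACE}, \mathrm{EXPTIME}, \mathrm{EXPSPACE}, \mathrm{2EXPTIME}\}$ (the classes of languages decided by deterministic Turing machines in space $p(n)$, time $2^{p(n)}$, space $2^{p(n)}$, and time $2^{2^{p(n)}}$, respectively, for some polynomial $p$), define two classes of functions $f\colon \Sigma^* \to \mathbb{N}$: - $\#C$ is the class of functions $f$ for which there is a nondeterministic Turing machine $\mathcal{M}$, terminating on every input and such that all its runs on inputs of length $n$ obey the resource bound of $C$ (space $p(n)$, time $2^{p(n)}$, space $2^{p(n)}$, or time $2^{2^{p(n)}}$, respectively, for some polynomial $p$), such that $f(w)$ is the number of accepting runs of $\mathcal{M}$ on $w$, for every $w \in \Sigma^*$. - $\#_oC$ is the class of functions $f$ for which there are a language $A \in C$ (over some finite alphabet) and a nondeterministic polynomial-time oracle Turing machine $\mathcal{M}$ with oracle $A$ (each oracle query is a single step) such that $f(w)$ is the number of accepting runs of $\mathcal{M}$ on $w$, for every $w \in \Sigma^*$. Lemma. For every finite nonempty alphabet $\Sigma$ and every $C \in \{\mathrm{PSPACE}, \mathrm{EXPTIME}, \mathrm{EXPSPACE},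 \mathrm{2EXPTIME}\}$, $$\#_oC \subsetneq \#C.$$ -/

import Mathlib

namespace CountingClasses

/-! ### Finite computations of a step relation -/

/-- `l` is a finite sequence `c₀, c₁, …, c_m` with `c₀ = a` in which every `c_{i+1}` is a successor
of `c_i`. It consists of `m = l.length - 1` steps. -/
def IsComputation {α : Type*} (step : α → α → Prop) (a : α) (l : List α) : Prop :=
  l.head? = some a ∧ l.IsChain step

/-- Every computation from `a` has at most `t` steps. -/
def HaltsWithin {α : Type*} (step : α → α → Prop) (a : α) (t : ℕ) : Prop :=
  ∀ l, IsComputation step a l → l.length ≤ t + 1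

/-- The computations from `a` whose last element satisfies `acc`. -/
def acceptingComputations {α : Type*} (step : α → α → Prop) (acc : α → Prop) (a : α) :
    Set (List α) :=
  {l | IsComputation step a l ∧ ∃ c, l.getLast? = some c ∧ acc c}

/-! ### Nondeterministic Turing machines -/

/-- Head movements. -/
inductive Move
  | left
  | stay
  | right

/-- The displacement of the head. -/
def Move.toInt : Move → ℤ
  | .left => -1
  | .stay => 0
  | .right => 1

/-- A nondeterministic Turing machine with input alphabet `I`. It has finitely many two-way infinite
tapes, one of which initially holds the input. The transition function maps a state and the scanned
symbols to the set of allowed triples (next state, symbols to write, head movements). -/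
structure NTM (I : Type) where
  State : Type
  Sym : Type
  Tape : Type
  finite_state : Finite State
  finite_sym : Finite Sym
  finite_tape : Finite Tape
  start : State
  accept : Set State
  blank : Sym
  input : I ↪ Sym
  input_ne_blank : ∀ a, input a ≠ blank
  inputTape : Tape
  trans : State → (Tape → Sym) → Set (State × (Tape → Sym) × (Tape → Move))

/-- A configuration: the state, and for every tape the head position and the contents. -/
structure NTM.Cfg {I : Type} (M : NTM I) where
  state : M.State
  head : M.Tape → ℤ
  cells : M.Tape → ℤ → M.Sym

namespace NTM

variable {I : Type} (M : NTM I)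

/-- The contents of a tape on which the word `w` is written in the cells `0, …, |w| - 1`. -/
def wordCells (w : List I) (z : ℤ) : M.Sym :=
  if 0 ≤ z then (w[z.toNat]?.map M.input).getD M.blank else M.blank

open Classical in
/-- The initial configuration: all heads are on cell `0`, the input is on the input tape, and all
other tapes are blank. -/
noncomputable def initial (w : List I) : M.Cfg where
  state := M.start
  head := fun _ => 0
  cells := fun i => if i = M.inputTape then M.wordCells w else fun _ => M.blank

variable {M}

/-- The symbols under the heads. -/
def Cfg.scanned (c : M.Cfg) : M.Tape → M.Sym :=
  fun i => c.cells i (c.head i)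

/-- Apply a transition: change the state, write on all tapes, then move all heads. -/
def Cfg.apply (c : M.Cfg) (t : M.State × (M.Tape → M.Sym) × (M.Tape → Move)) : M.Cfg where
  state := t.1
  head := fun i => c.head i + (t.2.2 i).toInt
  cells := fun i => Function.update (c.cells i) (c.head i) (t.2.1 i)

variable (M)

/-- The configuration is accepting. -/
def Accepting (c : M.Cfg) : Prop := c.state ∈ M.accept

/-- The successor relation; accepting states are terminal. Distinct transitions lead to distinct
configurations, so sequences of configurations are the same as sequences of transitions. -/
def Step (c c' : M.Cfg) : Prop :=
  ¬ M.Accepting c ∧ ∃ t ∈ M.trans c.state c.scanned, c' = c.apply t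

/-- The accepting runs on `w`: they start in the initial configuration and end in an accepting
configuration, which has no successor. -/
def acceptingRuns (w : List I) : Set (List M.Cfg) :=
  acceptingComputations M.Step M.Accepting (M.initial w)

/-- On every input there is a bound on the length of all runs. -/
def Terminates : Prop := ∀ w, ∃ t, HaltsWithin M.Step (M.initial w) t

/-- On inputs of length `n` every run has at most `t n` steps. -/
def TimeBounded (t : ℕ → ℕ) : Prop := ∀ w, HaltsWithin M.Step (M.initial w) (t w.length)

/-- On inputs of length `n` only the cells `-s n, …, s n` of each tape are ever visited. -/
def SpaceBounded (s : ℕ → ℕ) : Prop :=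
  ∀ w c, Relation.ReflTransGen M.Step (M.initial w) c → ∀ i, |c.head i| ≤ (s w.length : ℤ)

/-- At most one transition is applicable at a time. -/
def Deterministic : Prop := ∀ q a, (M.trans q a).Subsingleton

/-- `w` is in `L` if and only if there is an accepting run on `w`. -/
def Accepts (L : Language I) : Prop := ∀ w, w ∈ L ↔ (M.acceptingRuns w).Nonempty

end NTM

/-! ### Oracle machines -/

/-- A nondeterministic oracle Turing machine with input alphabet `I`, for oracles over the
alphabet `Q`: it has an oracle tape (an additional read-write tape) and three special states. -/
structure OracleNTM (I Q : Type) extends NTM I where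
  query : Q ↪ Sym
  query_ne_blank : ∀ a, query a ≠ blank
  oracleTape : Tape
  oracleTape_ne : oracleTape ≠ inputTape
  askState : State
  yesState : State
  noState : State

namespace OracleNTM

variable {I Q : Type} (M : OracleNTM I Q)

/-- The word on the oracle tape is `v`: it is written from cell `0` on, and the cell after it does
not hold a symbol of the oracle's alphabet. -/
def IsQuery (c : M.toNTM.Cfg) (v : List Q) : Prop :=
  (∀ (n : ℕ) (h : n < v.length), c.cells M.oracleTape n = M.query v[n]) ∧
    ∀ a, c.cells M.oracleTape v.length ≠ M.query a

open Classical in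
/-- The successor relation with oracle `A`. In the state `askState` the oracle is asked, in one step,
whether the word on the oracle tape is in `A`; in all other states the machine makes an
ordinary step. -/
def Step (A : Language Q) (c c' : M.toNTM.Cfg) : Prop :=
  if c.state = M.askState then
    ¬ M.toNTM.Accepting c ∧ ∃ v, M.IsQuery c v ∧
      c' = { c with state := if v ∈ A then M.yesState else M.noState }
  else M.toNTM.Step c c'

/-- The accepting runs on `w` with oracle `A`. -/
def acceptingRuns (A : Language Q) (w : List I) : Set (List M.toNTM.Cfg) :=
  acceptingComputations (M.Step A) M.toNTM.Accepting (M.toNTM.initial w)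

/-- With oracle `A`, every run on inputs of length `n` has at most `t n` steps. -/
def TimeBounded (A : Language Q) (t : ℕ → ℕ) : Prop :=
  ∀ w, HaltsWithin (M.Step A) (M.toNTM.initial w) (t w.length)

end OracleNTM

/-! ### Complexity classes -/

/-- Names of the four resource bounds. -/
inductive ResourceClass
  | pspace
  | exptime
  | expspace
  | twoExptime

/-- The machine `M` obeys the resource bound: polynomial space, exponential time, exponential space,
or doubly-exponential time. -/
def ResourceClass.Bounds {I : Type} : ResourceClass → NTM I → Prop
  | .pspace, M => ∃ p : Polynomial ℕ, M.SpaceBounded fun n => p.eval n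
  | .exptime, M => ∃ p : Polynomial ℕ, M.TimeBounded fun n => 2 ^ p.eval n
  | .expspace, M => ∃ p : Polynomial ℕ, M.SpaceBounded fun n => 2 ^ p.eval n
  | .twoExptime, M => ∃ p : Polynomial ℕ, M.TimeBounded fun n => 2 ^ 2 ^ p.eval n

/-- The class of decision problems: PSPACE, EXPTIME, EXPSPACE, 2EXPTIME. -/
def ResourceClass.languages (C : ResourceClass) (I : Type) : Set (Language I) :=
  {L | ∃ M : NTM I, M.Deterministic ∧ M.Terminates ∧ C.Bounds M ∧ M.Accepts L}

/-- The class `#C`: functions counting the accepting runs of nondeterministic terminating machines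
within the resource bound. -/
def ResourceClass.sharp (C : ResourceClass) (I : Type) : Set (List I → ℕ) :=
  {f | ∃ M : NTM I, M.Terminates ∧ C.Bounds M ∧ ∀ w, (M.acceptingRuns w).encard = f w}

/-- The class `#ₒ𝒞` for a class `𝒞` of decision problems over finite alphabets: functions counting
the accepting runs of nondeterministic polynomial-time machines with an oracle from `𝒞`. -/
def sharpOracle (𝒞 : (Q : Type) → Set (Language Q)) (I : Type) : Set (List I → ℕ) :=
  {f | ∃ (Q : Type) (_ : Finite Q) (A : Language Q) (M : OracleNTM I Q) (p : Polynomial ℕ),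
    A ∈ 𝒞 Q ∧ M.TimeBounded A (fun n => p.eval n) ∧
      ∀ w, (M.acceptingRuns A w).encard = f w}

end CountingClasses

/-! Inclusion. A deterministic terminating procedure has exactly one maximal computation on each
query. Running it in place of an oracle query therefore lengthens the runs of the oracle machine but
neither splits nor merges them, and the number of accepting runs is preserved (`Simulates`,
`callSimulates_main`). A polynomial-time machine asks polynomially many queries of polynomial
length, and all four resource bounds absorb the resulting overhead (`callMachine_bounds`).

Two points need care. The procedure expects clean tapes at every call, but its tapes are never
erased. They are initialised lazily: a call starts wherever the heads happen to be, the ends of the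
interval visited in this call are marked, and a head that passes a mark enters a new cell whose
initial content is known (`LazyTape`). On the input tape this content is a letter of the query; it
is read from the oracle tape, whose head moves in step with the input head of the procedure.
Afterwards the oracle head must return to its old place; two tapes with a mark on cell 0 serve as
counters for its position and its displacement.

Strictness. A polynomial-time oracle machine has at most `B ^ p(n)` accepting runs, whatever its
oracle (`finite_and_card_acceptingComputations_le`). A counter on a linear stretch of tape makes
exponentially many steps; if it tosses a coin in each of them and always accepts, it has doubly
exponentially many accepting runs, and it still obeys all four bounds (`odometerRuns_initial`,
`odometer_bounds`). -/

namespace CountingClasses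

/-! ### Counting accepting computations -/

section Computations

variable {α β ι : Type*} {step : α → α → Prop} {acc : α → Prop} {a : α}

theorem isComputation_cons {b : α} {l : List α} :
    IsComputation step a (b :: l) ↔
      b = a ∧ (l = [] ∨ ∃ a', step a a' ∧ IsComputation step a' l) := by
  cases l with
  | nil => simp [IsComputation]
  | cons x l =>
    simp only [IsComputation, List.head?_cons, Option.some.injEq, List.isChain_cons_cons,
      reduceCtorEq, false_or]
    constructor
    · rintro ⟨rfl, h, h'⟩
      exact ⟨rfl, x, h, rfl, h'⟩
    · rintro ⟨rfl, y, h, rfl, h'⟩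
      exact ⟨rfl, h, h'⟩

theorem not_isComputation_nil : ¬ IsComputation step a [] := by
  simp [IsComputation]

theorem IsComputation.ne_nil {l : List α} (h : IsComputation step a l) : l ≠ [] := by
  rintro rfl
  exact not_isComputation_nil h

theorem IsComputation.singleton : IsComputation step a [a] := by
  simp [IsComputation]

theorem IsComputation.cons {a' : α} {l : List α} (h : step a a') (hl : IsComputation step a' l) :
    IsComputation step a (a :: l) :=
  isComputation_cons.2 ⟨rfl, Or.inr ⟨a', h, hl⟩⟩

theorem HaltsWithin.mono {s t : ℕ} (h : HaltsWithin step a s) (hst : s ≤ t) :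
    HaltsWithin step a t :=
  fun l hl => (h l hl).trans (by lia)

theorem haltsWithin_of_forall_step {t : ℕ}
    (h : ∀ a', step a a' → ∃ s < t, HaltsWithin step a' s) : HaltsWithin step a t := by
  rintro (_ | ⟨b, l⟩) hl
  · simp
  · obtain ⟨rfl, rfl | ⟨a', ha', hl'⟩⟩ := isComputation_cons.1 hl
    · simp
    · obtain ⟨s, hs, hh⟩ := h a' ha'
      have := hh l hl'
      simp only [List.length_cons]
      lia

theorem HaltsWithin.of_step {t : ℕ} (h : HaltsWithin step a t) {a' : α} (ha : step a a') :
    ∃ s, t = s + 1 ∧ HaltsWithin step a' s := by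
  cases t with
  | zero => simpa using h [a, a'] (.cons ha .singleton)
  | succ t => exact ⟨t, rfl, fun l hl => by simpa using h (a :: l) (.cons ha hl)⟩

theorem acceptingComputations_of_acc (ha : acc a) (hs : ∀ x, ¬ step a x) :
    acceptingComputations step acc a = {[a]} := by
  ext l
  simp only [acceptingComputations, Set.mem_ofPred_eq, Set.mem_singleton_iff]
  constructor
  · rintro ⟨h, -⟩
    cases l with
    | nil => exact (not_isComputation_nil h).elim
    | cons b l =>
      obtain ⟨rfl, rfl | ⟨a', h, -⟩⟩ := isComputation_cons.1 h
      · rfl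
      · exact (hs _ h).elim
  · rintro rfl
    exact ⟨.singleton, a, by simp, ha⟩

theorem mem_acceptingComputations_cons {a' : α} {l : List α} (h : step a a')
    (hl : l ∈ acceptingComputations step acc a') : a :: l ∈ acceptingComputations step acc a := by
  obtain ⟨hl, c, hc, hacc⟩ := hl
  refine ⟨.cons h hl, c, ?_, hacc⟩
  rw [List.getLast?_cons, hc]
  rfl

theorem exists_of_mem_acceptingComputations (ha : ¬ acc a) {l : List α}
    (hl : l ∈ acceptingComputations step acc a) :
    ∃ a' l', step a a' ∧ l' ∈ acceptingComputations step acc a' ∧ l = a :: l' := by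
  obtain ⟨hl, c, hc, hacc⟩ := hl
  cases l with
  | nil => exact (not_isComputation_nil hl).elim
  | cons b l =>
    obtain ⟨rfl, rfl | ⟨a', h, hl'⟩⟩ := isComputation_cons.1 hl
    · simp only [List.getLast?_singleton, Option.some.injEq] at hc
      exact (ha (hc ▸ hacc)).elim
    · refine ⟨a', l, h, ⟨hl', c, ?_, hacc⟩, rfl⟩
      obtain ⟨y, l, rfl⟩ := List.exists_cons_of_ne_nil hl'.ne_nil
      simpa [List.getLast?_cons_cons] using hc

/-- Deleting the first configuration is the bijection; the head of the remaining list determines `f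
i`, and injectivity recovers `i`. The free index type allows the successors in two different
machines to be matched. -/
theorem nonempty_equiv_sigma_acceptingComputations (ha : ¬ acc a) {f : ι → α}
    (hf : Function.Injective f) (hs : ∀ x, step a x ↔ ∃ i, f i = x) :
    Nonempty (acceptingComputations step acc a ≃
      Σ i, acceptingComputations step acc (f i)) := by
  let F : (Σ i, acceptingComputations step acc (f i)) → acceptingComputations step acc a :=
    fun x => ⟨a :: x.2.1, mem_acceptingComputations_cons ((hs _).2 ⟨x.1, rfl⟩) x.2.2⟩
  refine ⟨(Equiv.ofBijective F ⟨?_, ?_⟩).symm⟩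
  · rintro ⟨i, l, hl⟩ ⟨j, l', hl'⟩ h
    simp only [F, Subtype.mk.injEq, List.cons.injEq, true_and] at h
    subst h
    have hij : i = j := by
      have h₁ := hl.1.1
      rw [hl'.1.1] at h₁
      exact (hf (Option.some.inj h₁)).symm
    subst hij
    rfl
  · rintro ⟨l, hl⟩
    obtain ⟨a', l', h, hl', rfl⟩ := exists_of_mem_acceptingComputations ha hl
    obtain ⟨i, rfl⟩ := (hs _).1 h
    exact ⟨⟨i, l', hl'⟩, rfl⟩

/-- The computations form a tree of depth at most `t` and branching at most `B`. The condition `1 ≤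
B` covers an accepting configuration with time to spare, where one computation is to be bounded by
`B ^ t`. -/
theorem finite_and_card_acceptingComputations_le {B : ℕ} (hB : 1 ≤ B)
    (hacc : ∀ a x, acc a → ¬ step a x)
    (hstep : ∀ a, Finite {x // step a x} ∧ Nat.card {x // step a x} ≤ B) (t : ℕ) (a : α)
    (h : HaltsWithin step a t) :
    Finite (acceptingComputations step acc a) ∧
      Nat.card (acceptingComputations step acc a) ≤ B ^ t := by
  induction t using Nat.strong_induction_on generalizing a with
  | _ t ih =>
    by_cases ha : acc a
    · rw [acceptingComputations_of_acc ha (hacc a · ha)]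
      refine ⟨inferInstance, ?_⟩
      simpa using Nat.one_le_pow _ _ hB
    · obtain ⟨e⟩ := nonempty_equiv_sigma_acceptingComputations (step := step) ha
        (f := fun x : {x // step a x} => x.1) Subtype.val_injective (by simp)
      obtain ⟨hfin, hcard⟩ := hstep a
      have := Fintype.ofFinite {x // step a x}
      have key : ∀ x : {x // step a x}, Finite (acceptingComputations step acc x.1) ∧
          Nat.card (acceptingComputations step acc x.1) ≤ B ^ (t - 1) := by
        rintro ⟨x, hx⟩
        obtain ⟨s, rfl, hs⟩ := h.of_step hx
        exact ih s (by lia) x hs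
      have := fun x => (key x).1
      refine ⟨Finite.of_equiv _ e.symm, ?_⟩
      rw [Nat.card_congr e, Nat.card_sigma]
      rcases isEmpty_or_nonempty {x // step a x} with hE | ⟨x, hx⟩
      · simp
      · obtain ⟨s, rfl, hs⟩ := h.of_step hx
        calc _ ≤ ∑ _x : {x // step a x}, B ^ s := Finset.sum_le_sum fun x _ => (key x).2
          _ = Nat.card {x // step a x} * B ^ s := by simp
          _ ≤ B * B ^ s := Nat.mul_le_mul_right _ hcard
          _ = B ^ (s + 1) := by ring

end Computations

/-! ### Simulations preserving the number of accepting computations -/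

/-- The accepting computations from `a` correspond to those from `b`, all computations from `b`
have at most `t` steps, and everything reachable from `b` satisfies `P`. -/
structure Simulates {α β : Type*} (step : α → α → Prop) (acc : α → Prop) (step' : β → β → Prop)
    (acc' : β → Prop) (P : β → Prop) (a : α) (b : β) (t : ℕ) : Prop where
  equiv : Nonempty (acceptingComputations step acc a ≃ acceptingComputations step' acc' b)
  halts : HaltsWithin step' b t
  safe : ∀ x, Relation.ReflTransGen step' b x → P x

namespace Simulates

variable {α β ι : Type*} {step : α → α → Prop} {acc : α → Prop} {step' : β → β → Prop}
  {acc' : β → Prop} {P : β → Prop} {a : α} {b : β} {s t : ℕ}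

theorem mono (h : Simulates step acc step' acc' P a b s) (hst : s ≤ t) :
    Simulates step acc step' acc' P a b t :=
  ⟨h.equiv, h.halts.mono hst, h.safe⟩

theorem of_acc (ha : acc a) (has : ∀ x, ¬ step a x) (hb : acc' b) (hbs : ∀ x, ¬ step' b x)
    (hP : P b) : Simulates step acc step' acc' P a b t where
  equiv := by
    rw [acceptingComputations_of_acc ha has, acceptingComputations_of_acc hb hbs]
    exact ⟨Equiv.ofUnique _ _⟩
  halts := haltsWithin_of_forall_step fun x hx => (hbs x hx).elim
  safe x hx := by
    rcases hx.cases_head with rfl | ⟨y, hy, -⟩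
    · exact hP
    · exact (hbs y hy).elim

theorem of_forall_step (ha : ¬ acc a) (hb : ¬ acc' b) (hP : P b) {f : ι → α} {g : ι → β}
    (hf : Function.Injective f) (hg : Function.Injective g) (hfs : ∀ x, step a x ↔ ∃ i, f i = x)
    (hgs : ∀ x, step' b x ↔ ∃ i, g i = x)
    (h : ∀ i, ∃ s < t, Simulates step acc step' acc' P (f i) (g i) s) :
    Simulates step acc step' acc' P a b t where
  equiv := by
    obtain ⟨e⟩ := nonempty_equiv_sigma_acceptingComputations (step := step) ha hf hfs
    obtain ⟨e'⟩ := nonempty_equiv_sigma_acceptingComputations (step := step') hb hg hgs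
    choose s _ h using h
    exact ⟨e.trans ((Equiv.sigmaCongrRight fun i => Classical.choice (h i).equiv).trans e'.symm)⟩
  halts := haltsWithin_of_forall_step fun x hx => by
    obtain ⟨i, rfl⟩ := (hgs x).1 hx
    obtain ⟨s, hs, h⟩ := h i
    exact ⟨s, hs, h.halts⟩
  safe x hx := by
    rcases hx.cases_head with rfl | ⟨y, hy, hyx⟩
    · exact hP
    · obtain ⟨i, rfl⟩ := (hgs y).1 hy
      obtain ⟨s, -, h⟩ := h i
      exact h.safe x hyx

/-- A forced step is a single branch, so the count does not change while the other machine waits.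
Together with `of_step_right` this matches one oracle step with the many steps of a call. -/
theorem of_step_left (ha : ¬ acc a) {a' : α} (hs : ∀ x, step a x ↔ x = a')
    (h : Simulates step acc step' acc' P a' b t) : Simulates step acc step' acc' P a b t where
  equiv := by
    obtain ⟨e⟩ := nonempty_equiv_sigma_acceptingComputations (step := step) ha
      (f := fun _ : Unit => a') (Function.injective_of_subsingleton _) (by simp [hs, eq_comm])
    obtain ⟨e'⟩ := h.equiv
    exact ⟨(e.trans (Equiv.uniqueSigma _)).trans e'⟩
  halts := h.halts
  safe := h.safe

theorem of_step_right (hb : ¬ acc' b) {b' : β} (hs : ∀ x, step' b x ↔ x = b') (hP : P b)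
    (h : Simulates step acc step' acc' P a b' t) :
    Simulates step acc step' acc' P a b (t + 1) where
  equiv := by
    obtain ⟨e⟩ := nonempty_equiv_sigma_acceptingComputations (step := step') hb
      (f := fun _ : Unit => b') (Function.injective_of_subsingleton _) (by simp [hs, eq_comm])
    obtain ⟨e'⟩ := h.equiv
    exact ⟨e'.trans (e.trans (Equiv.uniqueSigma _)).symm⟩
  halts := haltsWithin_of_forall_step fun x hx => ⟨t, by lia, (hs x).1 hx ▸ h.halts⟩
  safe x hx := by
    rcases hx.cases_head with rfl | ⟨y, hy, hyx⟩
    · exact hP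
    · exact h.safe x ((hs y).1 hy ▸ hyx)

end Simulates

/-! ### Steps of Turing machines -/

theorem Move.toInt_injective : Function.Injective Move.toInt := by
  rintro (_ | _ | _) (_ | _ | _) h <;> simp_all [Move.toInt]

instance : Finite Move :=
  Finite.of_surjective (fun i : Fin 3 => ![Move.left, Move.stay, Move.right] i) <| by
    rintro (_ | _ | _)
    exacts [⟨0, rfl⟩, ⟨1, rfl⟩, ⟨2, rfl⟩]

theorem Move.abs_toInt_le (m : Move) : |m.toInt| ≤ 1 := by
  cases m <;> simp [Move.toInt]

namespace NTM

variable {I : Type} {M : NTM I}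

theorem Cfg.apply_injective (c : M.Cfg) : Function.Injective c.apply := by
  rintro ⟨q, x, m⟩ ⟨q', x', m'⟩ h
  simp only [Cfg.apply, Cfg.mk.injEq] at h
  obtain ⟨rfl, h₂, h₃⟩ := h
  obtain rfl : m = m' := funext fun i => Move.toInt_injective (by simpa using congrFun h₂ i)
  obtain rfl : x = x' := funext fun i => by
    simpa using congrFun (congrFun h₃ i) (c.head i)
  rfl

theorem step_iff {c x : M.Cfg} (h : ¬ M.Accepting c) :
    M.Step c x ↔ ∃ t : M.trans c.state c.scanned, c.apply t.1 = x := by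
  simp only [Step, h, not_false_eq_true, true_and, Subtype.exists, exists_prop, eq_comm]

theorem step_iff_of_trans_eq {c x : M.Cfg} (h : ¬ M.Accepting c)
    {t : M.State × (M.Tape → M.Sym) × (M.Tape → Move)}
    (ht : M.trans c.state c.scanned = {t}) : M.Step c x ↔ x = c.apply t := by
  simp [Step, h, ht]

theorem Cfg.abs_head_apply_le (c : M.Cfg) (t : M.State × (M.Tape → M.Sym) × (M.Tape → Move))
    {k : ℕ} {i : M.Tape} (h : |c.head i| ≤ k) : |(c.apply t).head i| ≤ (k + 1 : ℕ) := by
  have := (t.2.2 i).abs_toInt_le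
  simp only [Cfg.apply, abs_le, Nat.cast_add, Nat.cast_one] at *
  lia

theorem abs_head_le_of_haltsWithin {c x : M.Cfg} {t k : ℕ} (h : HaltsWithin M.Step c t)
    (hk : ∀ i, |c.head i| ≤ k) (hx : Relation.ReflTransGen M.Step c x) (i : M.Tape) :
    |x.head i| ≤ (k + t : ℕ) := by
  induction hx using Relation.ReflTransGen.head_induction_on generalizing t k with
  | refl => exact (hk i).trans (by simp)
  | head hs _ ih =>
    obtain ⟨s, rfl, hh⟩ := h.of_step hs
    obtain ⟨-, u, -, rfl⟩ := hs
    refine (ih hh (k := k + 1) fun i => Cfg.abs_head_apply_le _ _ (hk i)).trans ?_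
    push_cast
    lia

end NTM

/-! ### A machine with doubly exponentially many accepting runs -/

section Odometer

/-- What the odometer does when it moves right (`true`) or left (`false`) and reads a symbol:
input symbols are the digit `0`, and `false` and `true` are the digits `1` and `2`. -/
def odometerNext {I : Type} (a₀ : I) :
    Bool → Option (I ⊕ Bool) → Option Bool × Option (I ⊕ Bool) × Move
  | true, none => (some false, none, .left)
  | false, none => (none, none, .stay)
  | _, some (.inl _) => (some true, some (.inr false), .right)
  | _, some (.inr false) => (some true, some (.inr true), .right)
  | _, some (.inr true) => (some false, some (.inl a₀), .left)

/-- A machine that counts to an exponential number on its tape and tosses a coin in each step. -/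
def odometer {I : Type} [Finite I] (a₀ : I) : NTM I where
  State := Option Bool × Bool
  Sym := Option (I ⊕ Bool)
  Tape := Unit
  finite_state := inferInstance
  finite_sym := inferInstance
  finite_tape := inferInstance
  start := (some true, true)
  accept := {q | q.1 = none}
  blank := none
  input := ⟨fun a => some (.inl a), fun _ _ h => by simpa using h⟩
  input_ne_blank := by simp
  inputTape := ()
  trans q x := {t | ∃ d, q.1 = some d ∧ ∃ coin, t = (((odometerNext a₀ d (x ())).1, coin),
    fun _ => (odometerNext a₀ d (x ())).2.1, fun _ => (odometerNext a₀ d (x ())).2.2)}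

/-- The number of steps in which the odometer runs through `k` digits. -/
def odometerSteps : ℕ → ℕ
  | 0 => 1
  | k + 1 => 2 * odometerSteps k + 3

theorem two_pow_le_odometerSteps (k : ℕ) : 2 ^ k ≤ odometerSteps k := by
  induction k with
  | zero => simp [odometerSteps]
  | succ k ih => simp only [odometerSteps, pow_succ]; lia

theorem odometerSteps_add_three (k : ℕ) : odometerSteps k + 3 = 2 ^ (k + 2) := by
  induction k with
  | zero => simp [odometerSteps]
  | succ k ih => simp only [odometerSteps, pow_succ] at *; lia

variable {I : Type} [Finite I] {a₀ : I}

/-- The direction in which the odometer moves, or `none` if it has accepted. -/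
def odometerDir (c : (odometer a₀).Cfg) : Option Bool := c.state.1

/-- The position of the head of the odometer. -/
def odometerHead (c : (odometer a₀).Cfg) : ℤ := c.head ()

/-- The tape of the odometer. -/
def odometerCells (c : (odometer a₀).Cfg) : ℤ → Option (I ⊕ Bool) := c.cells ()

/-- The symbol under the head of the odometer. -/
def odometerScan (c : (odometer a₀).Cfg) : Option (I ⊕ Bool) := odometerCells c (odometerHead c)

/-- From `c` there are `2 ^ m` accepting runs, all runs have at most `m` steps and the head stays
in the cells `-B, …, B`. -/
structure OdometerRuns (B : ℤ) (c : (odometer a₀).Cfg) (m : ℕ) : Prop where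
  card : Nat.card (acceptingComputations (odometer a₀).Step (odometer a₀).Accepting c) = 2 ^ m
  halts : HaltsWithin (odometer a₀).Step c m
  safe : ∀ x, Relation.ReflTransGen (odometer a₀).Step c x → |odometerHead x| ≤ B

/-- The odometer moves on from `c` with the given outcome of the coin toss. -/
def odometerSucc (c : (odometer a₀).Cfg) (d : Bool) (coin : Bool) : (odometer a₀).Cfg :=
  c.apply (((odometerNext a₀ d (odometerScan c)).1, coin),
    fun _ => (odometerNext a₀ d (odometerScan c)).2.1,
    fun _ => (odometerNext a₀ d (odometerScan c)).2.2)

theorem odometerDir_succ (c : (odometer a₀).Cfg) (d coin : Bool) :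
    odometerDir (odometerSucc c d coin) = (odometerNext a₀ d (odometerScan c)).1 := rfl

theorem odometerHead_succ (c : (odometer a₀).Cfg) (d coin : Bool) :
    odometerHead (odometerSucc c d coin) =
      odometerHead c + (odometerNext a₀ d (odometerScan c)).2.2.toInt := rfl

theorem odometerCells_succ (c : (odometer a₀).Cfg) (d coin : Bool) (z : ℤ) :
    odometerCells (odometerSucc c d coin) z =
      if z = odometerHead c then (odometerNext a₀ d (odometerScan c)).2.1
      else odometerCells c z := by
  rw [← Function.update_apply]
  rfl

theorem odometer_accepting_iff {c : (odometer a₀).Cfg} :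
    (odometer a₀).Accepting c ↔ odometerDir c = none := Iff.rfl

theorem odometer_step_iff {c x : (odometer a₀).Cfg} {d : Bool} (hd : odometerDir c = some d) :
    (odometer a₀).Step c x ↔ ∃ coin, odometerSucc c d coin = x := by
  constructor
  · rintro ⟨-, t, ⟨d', hd', coin, rfl⟩, rfl⟩
    obtain rfl : d = d' := Option.some.inj (hd.symm.trans hd')
    exact ⟨coin, rfl⟩
  · rintro ⟨coin, rfl⟩
    exact ⟨by simp [odometer_accepting_iff, hd], _, ⟨d, hd, coin, rfl⟩, rfl⟩

/-- The outcome of the coin toss is kept in the state, so the two successors differ and the count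
doubles although the tape evolves deterministically. -/
theorem OdometerRuns.step {B : ℤ} {c : (odometer a₀).Cfg} {m : ℕ} {d : Bool}
    (hd : odometerDir c = some d) (hB : |odometerHead c| ≤ B)
    (h : ∀ coin, OdometerRuns B (odometerSucc c d coin) m) : OdometerRuns B c (m + 1) := by
  have hacc : ¬ (odometer a₀).Accepting c := by simp [odometer_accepting_iff, hd]
  have hs : ∀ x, (odometer a₀).Step c x ↔ ∃ coin, odometerSucc c d coin = x :=
    fun x => odometer_step_iff hd
  have hinj : Function.Injective (odometerSucc c d) := fun b b' hb =>
    (Prod.ext_iff.1 (Prod.ext_iff.1 (NTM.Cfg.apply_injective c hb)).1).2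
  refine ⟨?_, ?_, ?_⟩
  · obtain ⟨e⟩ := nonempty_equiv_sigma_acceptingComputations hacc hinj hs
    have (coin : Bool) : Finite (acceptingComputations (odometer a₀).Step
        (odometer a₀).Accepting (odometerSucc c d coin)) :=
      Nat.finite_of_card_ne_zero (by simp [(h coin).card])
    rw [Nat.card_congr e, Nat.card_sigma]
    simp [(h _).card, pow_succ, mul_comm]
  · refine haltsWithin_of_forall_step fun x hx => ?_
    obtain ⟨coin, rfl⟩ := (hs x).1 hx
    exact ⟨m, by lia, (h coin).halts⟩
  · intro x hx
    rcases hx.cases_head with rfl | ⟨y, hy, hyx⟩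
    · exact hB
    · obtain ⟨coin, rfl⟩ := (hs y).1 hy
      exact (h coin).safe x hyx

theorem OdometerRuns.of_accepting {B : ℤ} {c : (odometer a₀).Cfg} (hc : odometerDir c = none)
    (hB : |odometerHead c| ≤ B) : OdometerRuns B c 0 := by
  have hs : ∀ x, ¬ (odometer a₀).Step c x := fun x hx => hx.1 hc
  refine ⟨?_, haltsWithin_of_forall_step fun x hx => (hs x hx).elim, fun x hx => ?_⟩
  · rw [acceptingComputations_of_acc (odometer_accepting_iff.2 hc) hs]
    simp
  · rcases hx.cases_head with rfl | ⟨y, hy, -⟩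
    · exact hB
    · exact (hs y hy).elim

/-- Induction on the number of digits. The leftmost digit is raised to 1, the others are swept; it
is raised to 2, the others are swept again; it is reset to 0 and left to the left. This gives two
sweeps and three extra steps. The hypothesis `h` is a continuation: the coin tosses lead to many
configurations of the same shape, and each of them has to be continued. -/
theorem OdometerRuns.sweep {n k : ℕ} (hk : k ≤ n) {m : ℕ} (c : (odometer a₀).Cfg)
    (hstate : odometerDir c = some true) (hhead : odometerHead c = n - k)
    (hzero : ∀ z : ℤ, n - k ≤ z → z < n → ∃ a, odometerCells c z = some (.inl a))
    (hblank : odometerCells c n = none)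
    (h : ∀ c' : (odometer a₀).Cfg, odometerDir c' = some false → odometerHead c' = n - k - 1 →
      (∀ z : ℤ, n - k ≤ z → z < n → ∃ a, odometerCells c' z = some (.inl a)) →
      (∀ z : ℤ, z < n - k ∨ n ≤ z → odometerCells c' z = odometerCells c z) →
      OdometerRuns (n + 1) c' m) :
    OdometerRuns (n + 1) c (m + odometerSteps k) := by
  induction k generalizing m c with
  | zero =>
    simp only [Nat.cast_zero, sub_zero] at hhead h
    have hsc : odometerScan c = none := by simp only [odometerScan, hhead, hblank]
    refine .step hstate (by rw [hhead, abs_le]; lia) fun coin => h _ ?_ ?_ ?_ ?_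
    · rw [odometerDir_succ, hsc]; rfl
    · rw [odometerHead_succ, hsc, hhead]; rfl
    · intro z h₁ h₂
      lia
    · intro z _
      rw [odometerCells_succ, hsc, hhead]
      split_ifs with hz
      · rw [hz, hblank]; rfl
      · rfl
  | succ k ih =>
    push_cast at hhead hzero h
    have hk' : k ≤ n := by lia
    have hm : m + odometerSteps (k + 1) =
        m + 1 + odometerSteps k + 1 + odometerSteps k + 1 := by
      simp only [odometerSteps]; lia
    rw [hm]
    obtain ⟨a, ha⟩ := hzero (odometerHead c) (by lia) (by lia)
    have hsc : odometerScan c = some (.inl a) := ha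
    refine .step hstate (by rw [hhead, abs_le]; lia) fun coin => ih hk' _ ?_ ?_ ?_ ?_ ?_
    · rw [odometerDir_succ, hsc]; rfl
    · simp only [odometerHead_succ, hsc, odometerNext, Move.toInt, hhead]; lia
    · intro z h₁ h₂
      obtain ⟨b, hb⟩ := hzero z (by lia) h₂
      refine ⟨b, ?_⟩
      rw [odometerCells_succ, hhead, if_neg (by lia), hb]
    · rw [odometerCells_succ, hhead, if_neg (by lia), hblank]
    intro c₁ hs₁ hh₁ hz₁ ho₁
    have hsc₁ : odometerScan c₁ = some (.inr false) := by
      rw [odometerScan, ho₁ _ (by lia)]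
      rw [odometerCells_succ, hsc, hhead, if_pos (by lia)]
      rfl
    refine .step hs₁ (by rw [hh₁, abs_le]; lia) fun coin₁ => ih hk' _ ?_ ?_ ?_ ?_ ?_
    · rw [odometerDir_succ, hsc₁]; rfl
    · simp only [odometerHead_succ, hsc₁, odometerNext, Move.toInt, hh₁]; lia
    · intro z h₁ h₂
      obtain ⟨b, hb⟩ := hz₁ z (by lia) h₂
      refine ⟨b, ?_⟩
      rw [odometerCells_succ, hh₁, if_neg (by lia), hb]
    · rw [odometerCells_succ, hh₁, if_neg (by lia), ho₁ _ (by lia)]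
      rw [odometerCells_succ, hhead, if_neg (by lia), hblank]
    intro c₂ hs₂ hh₂ hz₂ ho₂
    have hsc₂ : odometerScan c₂ = some (.inr true) := by
      rw [odometerScan, ho₂ _ (by lia)]
      rw [odometerCells_succ, hsc₁, hh₁, if_pos (by lia)]
      rfl
    refine .step hs₂ (by rw [hh₂, abs_le]; lia) fun coin₂ => h _ ?_ ?_ ?_ ?_
    · rw [odometerDir_succ, hsc₂]; rfl
    · simp only [odometerHead_succ, hsc₂, odometerNext, Move.toInt, hh₂]; lia
    · intro z h₁ h₂
      rw [odometerCells_succ, hsc₂, hh₂]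
      split_ifs with hz
      · exact ⟨a₀, rfl⟩
      · exact hz₂ z (by lia) h₂
    · intro z hz
      rw [odometerCells_succ, hh₂, if_neg (by lia), ho₂ _ (by lia)]
      rw [odometerCells_succ, hh₁, if_neg (by lia), ho₁ _ (by lia)]
      rw [odometerCells_succ, hhead, if_neg (by lia)]

/-- After the sweep the head is on the blank cell `-1` and moves left. A blank read in this
direction leads to acceptance, which is the one step beyond `odometerSteps`. -/
theorem odometerRuns_initial (w : List I) :
    OdometerRuns (w.length + 1) ((odometer a₀).initial w) (1 + odometerSteps w.length) := by
  have hcells : odometerCells ((odometer a₀).initial w) = (odometer a₀).wordCells w :=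
    if_pos rfl
  refine .sweep le_rfl _ rfl (by simp [odometerHead, NTM.initial]) (fun z h₁ h₂ => ?_) ?_
    fun c hs hh _ ho => ?_
  · rw [hcells, NTM.wordCells, if_pos (by lia), List.getElem?_eq_getElem (by lia)]
    exact ⟨_, rfl⟩
  · rw [hcells, NTM.wordCells, if_pos (by lia), List.getElem?_eq_none (by lia)]
    rfl
  · have hsc : odometerScan c = none := by
      rw [odometerScan, hh, ho _ (by lia), hcells, NTM.wordCells, if_neg (by lia)]
      rfl
    refine .step (m := 0) hs (by rw [hh, abs_le]; lia) fun coin => .of_accepting ?_ ?_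
    · rw [odometerDir_succ, hsc]; rfl
    · simp only [odometerHead_succ, hsc, odometerNext, Move.toInt, hh, abs_le]
      lia

theorem encard_acceptingRuns_odometer (w : List I) :
    ((odometer a₀).acceptingRuns w).encard = (2 ^ (1 + odometerSteps w.length) : ℕ) := by
  have h := (odometerRuns_initial (a₀ := a₀) w).card
  have hfin : ((odometer a₀).acceptingRuns w).Finite :=
    Set.finite_coe_iff.1 (Nat.finite_of_card_ne_zero (by rw [NTM.acceptingRuns, h]; simp))
  rw [← hfin.cast_ncard_eq, ← Nat.card_coe_set_eq, NTM.acceptingRuns, h]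

theorem odometer_terminates : (odometer a₀).Terminates :=
  fun w => ⟨_, (odometerRuns_initial w).halts⟩

theorem odometer_bounds (C : ResourceClass) : C.Bounds (odometer a₀) := by
  have hsteps (n : ℕ) : 1 + odometerSteps n ≤ 2 ^ (n + 2) := by
    have := odometerSteps_add_three n
    lia
  have hspace (w : List I) (c : (odometer a₀).Cfg)
      (h : Relation.ReflTransGen (odometer a₀).Step ((odometer a₀).initial w) c)
      (i : (odometer a₀).Tape) : |c.head i| ≤ ((w.length + 1 : ℕ) : ℤ) := by
    exact_mod_cast (odometerRuns_initial w).safe c h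
  cases C with
  | pspace => exact ⟨.X + 1, fun w c h i => by simpa using hspace w c h i⟩
  | exptime =>
    refine ⟨.X + 2, fun w => (odometerRuns_initial w).halts.mono ?_⟩
    simpa using hsteps w.length
  | expspace =>
    refine ⟨.X + 1, fun w c h i => (hspace w c h i).trans ?_⟩
    exact_mod_cast by simpa using (Nat.lt_two_pow_self (n := w.length + 1)).le
  | twoExptime =>
    refine ⟨.X + 2, fun w => (odometerRuns_initial w).halts.mono ?_⟩
    simpa using (hsteps w.length).trans (Nat.pow_le_pow_right two_pos Nat.lt_two_pow_self.le)

theorem two_pow_odometerSteps_mem_sharp [Nonempty I] (C : ResourceClass) :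
    (fun w : List I => 2 ^ (1 + odometerSteps w.length)) ∈ C.sharp I :=
  ⟨odometer (Classical.arbitrary I), odometer_terminates, odometer_bounds C,
    encard_acceptingRuns_odometer⟩

end Odometer

/-! ### Oracle machines have few runs -/

namespace OracleNTM

variable {I Q : Type} (M : OracleNTM I Q) (A : Language Q)

/-- A successor is determined by a transition or by one bit of answer, so the bound is uniform in
the configuration. -/
theorem exists_card_successors_le : ∃ B, 1 ≤ B ∧ ∀ c,
    Finite {x // M.Step A c x} ∧ Nat.card {x // M.Step A c x} ≤ B := by
  have := M.finite_state
  have := M.finite_sym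
  have := M.finite_tape
  classical
  let T := (M.State × (M.Tape → M.Sym) × (M.Tape → Move)) ⊕ Bool
  refine ⟨Nat.card T, Nat.card_pos, fun c => ?_⟩
  let F : T → M.toNTM.Cfg := Sum.elim c.apply
    fun b => { c with state := if b then M.yesState else M.noState }
  have hF : ∀ x : {x // M.Step A c x}, ∃ t, F t = x.1 := by
    rintro ⟨x, hx⟩
    rw [Step] at hx
    split_ifs at hx
    · obtain ⟨-, v, -, rfl⟩ := hx
      exact ⟨.inr (decide (v ∈ A)), by simp [F]⟩
    · obtain ⟨-, t, -, rfl⟩ := hx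
      exact ⟨.inl t, rfl⟩
  choose g hg using hF
  have hinj : Function.Injective g := fun x y h => Subtype.ext (by rw [← hg, ← hg, h])
  exact ⟨Finite.of_injective g hinj, Nat.card_le_card_of_injective g hinj⟩

theorem not_step_of_accepting {c x : M.toNTM.Cfg} (h : M.toNTM.Accepting c) :
    ¬ M.Step A c x := by
  rw [Step]
  split_ifs
  · exact fun hx => hx.1 h
  · exact fun hx => hx.1 h

end OracleNTM

theorem exists_mul_eval_lt_two_pow (β : ℕ) (p : Polynomial ℕ) : ∃ n, β * p.eval n < 2 ^ n := by
  -- With `n = 2 * m` the known limit of a polynomial over `exp m` applies, because `e < 4` gives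
  -- `exp m ≤ 4 ^ m = 2 ^ n`.
  let q : Polynomial ℝ := (Polynomial.C (β : ℝ) * p.map (Nat.castRingHom ℝ)).comp (2 * .X)
  have h : ∀ᶠ m : ℕ in Filter.atTop, q.eval (m : ℝ) / Real.exp m < 1 :=
    (tendsto_natCast_atTop_atTop.eventually
      (q.tendsto_div_exp_atTop.eventually (gt_mem_nhds one_pos)))
  obtain ⟨m, hm⟩ := h.exists
  refine ⟨2 * m, ?_⟩
  rw [div_lt_one (Real.exp_pos _)] at hm
  have h₁ : q.eval (m : ℝ) = ((β * p.eval (2 * m) : ℕ) : ℝ) := by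
    have : (2 * m : ℝ) = Nat.castRingHom ℝ (2 * m) := by simp
    simp only [q, Polynomial.eval_comp, Polynomial.eval_mul, Polynomial.eval_C, Polynomial.eval_X,
      Polynomial.eval_ofNat]
    rw [this, Polynomial.eval_map, Polynomial.eval₂_at_apply]
    simp
  have h₂ : Real.exp m ≤ ((2 ^ (2 * m) : ℕ) : ℝ) := by
    rw [← Real.exp_one_pow, pow_mul]
    push_cast
    exact pow_le_pow_left₀ (Real.exp_pos _).le (by linarith [Real.exp_one_lt_d9]) _
  rw [h₁] at hm
  exact_mod_cast hm.trans_le h₂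

/-- At most `B ^ p(n) ≤ 2 ^ (B * p(n))` runs are available, while the exponent to be reached exceeds
`2 ^ n`. No property of the oracle enters, hence the arbitrary `𝒞`. -/
theorem two_pow_odometerSteps_notMem_sharpOracle {I : Type} [Nonempty I]
    (𝒞 : (Q : Type) → Set (Language Q)) :
    (fun w : List I => 2 ^ (1 + odometerSteps w.length)) ∉ sharpOracle 𝒞 I := by
  rintro ⟨Q, _, A, M, p, -, htime, hcount⟩
  obtain ⟨B, hB, hstep⟩ := M.exists_card_successors_le A
  obtain ⟨n, hn⟩ := exists_mul_eval_lt_two_pow B p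
  let w : List I := List.replicate n (Classical.arbitrary I)
  have hw : w.length = n := List.length_replicate ..
  obtain ⟨hfin, hcard⟩ := finite_and_card_acceptingComputations_le (acc := M.toNTM.Accepting) hB
    (fun a x ha => M.not_step_of_accepting A ha) hstep _ _ (htime w)
  have h := hcount w
  have hf : (M.acceptingRuns A w).Finite := Set.finite_coe_iff.1 hfin
  rw [← hf.cast_ncard_eq, ← Nat.card_coe_set_eq, Nat.cast_inj] at h
  rw [OracleNTM.acceptingRuns] at h
  rw [h, hw] at hcard
  have h₁ : B ^ p.eval n ≤ 2 ^ (B * p.eval n) := by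
    rw [pow_mul]
    exact Nat.pow_le_pow_left Nat.lt_two_pow_self.le _
  have h₂ := (Nat.pow_le_pow_iff_right one_lt_two).1 (hcard.trans h₁)
  have := two_pow_le_odometerSteps n
  lia

/-! ### Lazily initialised tapes -/

/-- `b` is the sign of `h`; the sign of `0` is arbitrary. -/
def HasSign (b : Bool) (h : ℤ) : Prop := if b then 0 ≤ h else h ≤ 0

/-- The opposite movement. -/
def Move.neg : Move → Move
  | .left => .right
  | .stay => .stay
  | .right => .left

theorem Move.toInt_neg (m : Move) : m.neg.toInt = -m.toInt := by
  cases m <;> rfl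

/-- The movement in the direction of a sign. -/
def Move.ofSign (b : Bool) : Move := if b then .right else .left

/-- The sign of the position after a movement, given whether the position was `0` before. -/
def nextSign (zero : Bool) (m : Move) (b : Bool) : Bool :=
  match zero, m with
  | true, .left => false
  | true, .right => true
  | _, _ => b

/-- The sign can change only when the head leaves 0, and then the movement determines it. So a
single mark on cell 0 is enough for the finite control to know the way back. -/
theorem HasSign.next {b : Bool} {h : ℤ} (hb : HasSign b h) (m : Move) :
    HasSign (nextSign (decide (h = 0)) m b) (h + m.toInt) := by
  rcases eq_or_ne h 0 with rfl | hh
  · cases m <;> simp_all [HasSign, nextSign, Move.toInt]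
  · cases m <;> cases b <;> simp_all [HasSign, nextSign, Move.toInt] <;> lia

/-- The marks (left end, right end) that remain in a cell when the head leaves it. -/
def remainingMarks (marks : Bool × Bool) : Move → Bool × Bool
  | .left => (false, marks.2)
  | .stay => marks
  | .right => (marks.1, false)

/-- The marks of the next cell if that cell is visited for the first time. -/
def nextFresh (marks : Bool × Bool) : Move → Option (Bool × Bool)
  | .left => if marks.1 then some (true, false) else none
  | .stay => none
  | .right => if marks.2 then some (false, true) else none

/-- The tape `lcells`, shifted by `d`, represents the tape `cells` on the interval `lo, …, hi` of
visited cells, the ends of which are marked. If the cell under the head is visited for the first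
time, it is not yet initialised and its marks are given by `fresh`. -/
structure LazyTape {Γ : Type*} (ini cells : ℤ → Γ) (h : ℤ) (lcells : ℤ → Γ × Bool × Bool) (d : ℤ)
    (fresh : Option (Bool × Bool)) (lo hi : ℤ) : Prop where
  lo_le : lo ≤ h
  le_hi : h ≤ hi
  lo_nonpos : lo ≤ 0
  hi_nonneg : 0 ≤ hi
  outside : ∀ z, z < lo ∨ hi < z → cells z = ini z
  of_fresh : ∀ m, fresh = some m →
    cells h = ini h ∧ m = (decide (h = lo), decide (h = hi)) ∧ (h = hi ∨ h < 0)
  old : ∀ z, lo ≤ z → z ≤ hi → (fresh = none ∨ z ≠ h) →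
    lcells (z + d) = (cells z, decide (z = lo), decide (z = hi))

namespace LazyTape

variable {Γ : Type*} {ini cells : ℤ → Γ} {h : ℤ} {lcells : ℤ → Γ × Bool × Bool} {d : ℤ}
  {fresh : Option (Bool × Bool)} {lo hi : ℤ}

theorem marks (H : LazyTape ini cells h lcells d fresh lo hi) :
    fresh.getD (lcells (h + d)).2 = (decide (h = lo), decide (h = hi)) := by
  cases fresh with
  | none => simp [H.old h H.lo_le H.le_hi (Or.inl rfl)]
  | some m => exact (H.of_fresh m rfl).2.1

/-- Nothing is assumed about `lcells`: the only visited cell is new, so whatever earlier calls left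
on the tape is invisible. -/
theorem initial (ini : ℤ → Γ) (lcells : ℤ → Γ × Bool × Bool) (d : ℤ) :
    LazyTape ini ini 0 lcells d (some (true, true)) 0 0 where
  lo_le := le_rfl
  le_hi := le_rfl
  lo_nonpos := le_rfl
  hi_nonneg := le_rfl
  outside _ _ := rfl
  of_fresh m hm := by simp [← Option.some.inj hm]
  old z h₁ h₂ h₃ := by
    rcases h₃ with h₃ | h₃
    · simp at h₃
    · lia

/-- The cell that is left loses the mark on the side of the movement: either it was not that end, or
the end moves on with the head. A new cell on the left is negative because `lo ≤ 0`, which preserves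
the last clause of `of_fresh`. -/
theorem step (H : LazyTape ini cells h lcells d fresh lo hi) (x : Γ) (m : Move) :
    LazyTape ini (Function.update cells h x) (h + m.toInt)
      (Function.update lcells (h + d)
        (x, remainingMarks (decide (h = lo), decide (h = hi)) m)) d
      (nextFresh (decide (h = lo), decide (h = hi)) m) (min lo (h + m.toInt))
      (max hi (h + m.toInt)) := by
  obtain ⟨h₁, h₂, h₃, h₄, h₅, h₆, h₇⟩ := H
  refine ⟨by lia, by lia, by lia, by lia, fun z hz => ?_, fun k hk => ?_, fun z hz₁ hz₂ hz₃ => ?_⟩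
  · rw [Function.update_of_ne (by lia), h₅ z (by lia)]
  · cases m with
    | stay => simp [nextFresh] at hk
    | left =>
      simp only [nextFresh, decide_eq_true_eq, Option.ite_none_right_eq_some,
        Option.some.injEq] at hk
      obtain ⟨rfl, rfl⟩ := hk
      simp only [Move.toInt]
      refine ⟨?_, ?_, by lia⟩
      · rw [Function.update_of_ne (by lia), h₅ _ (by lia)]
      · simp only [Prod.mk.injEq]
        lia
    | right =>
      simp only [nextFresh, decide_eq_true_eq, Option.ite_none_right_eq_some,
        Option.some.injEq] at hk
      obtain ⟨rfl, rfl⟩ := hk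
      simp only [Move.toInt]
      refine ⟨?_, ?_, by lia⟩
      · rw [Function.update_of_ne (by lia), h₅ _ (by lia)]
      · simp only [Prod.mk.injEq]
        lia
  · by_cases hzh : z = h
    · subst hzh
      rw [Function.update_self, Function.update_self]
      cases m <;>
        simp only [remainingMarks, Move.toInt, Prod.mk.injEq, true_and] <;> lia
    · have hlo : lo ≤ z ∧ z ≤ hi := by
        cases m <;> simp only [Move.toInt, nextFresh, decide_eq_true_eq, ite_eq_right_iff,
          reduceCtorEq, imp_false] at hz₁ hz₂ hz₃ <;> lia
      rw [Function.update_of_ne hzh, Function.update_of_ne (by lia),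
        h₇ z hlo.1 hlo.2 (Or.inr hzh)]
      cases m <;> simp only [Move.toInt, nextFresh, decide_eq_true_eq, ite_eq_right_iff,
        reduceCtorEq, imp_false, Prod.mk.injEq, true_and] at hz₁ hz₂ hz₃ ⊢ <;>
        lia

end LazyTape

/-! ### Replacing oracle queries by calls of a decision procedure -/

section Call

variable {I Q : Type} (M : OracleNTM I Q) (N : NTM Q)

/-- The states of the machine that calls `N` instead of asking the oracle: an initial state, the
states of `M` with the sign of the position on the oracle tape, states for moving to the beginning
of the query, states for running `N`, and states for returning with the answer. -/
inductive CallState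
  | init
  | main (q : M.State) (sign : Bool)
  | seek (sign : Bool)
  | run (q : N.State) (fresh : N.Tape → Option (Bool × Bool)) (word dispSign sign : Bool)
  | ret (answer dispSign sign : Bool)

/-- The tapes: those of `M`, those of `N`, and two tapes on which only the cell `0` is marked. One
of them holds the position on the oracle tape, the other one the displacement from the position at
the time of the query. -/
inductive CallTape
  | main (i : M.Tape)
  | sub (j : N.Tape)
  | pos
  | disp

/-- The symbols: each tape uses one of the components. -/
abbrev CallSym : Type := M.Sym × (N.Sym × Bool × Bool) × Bool

/-- The transitions. -/
abbrev CallTransition : Type :=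
  CallState M N × (CallTape M N → CallSym M N) × (CallTape M N → Move)

theorem CallState.finite : Finite (CallState M N) := by
  have := M.finite_state
  have := N.finite_state
  have := N.finite_tape
  let F : Unit ⊕ (M.State × Bool) ⊕ Bool ⊕
      (N.State × (N.Tape → Option (Bool × Bool)) × Bool × Bool × Bool) ⊕ (Bool × Bool × Bool) →
      CallState M N :=
    Sum.elim (fun _ => .init) <| Sum.elim (fun x => .main x.1 x.2) <| Sum.elim .seek <|
      Sum.elim (fun x => .run x.1 x.2.1 x.2.2.1 x.2.2.2.1 x.2.2.2.2)
        fun x => .ret x.1 x.2.1 x.2.2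
  refine Finite.of_surjective F ?_
  rintro (_ | ⟨q, s⟩ | s | ⟨q, f, w, t, s⟩ | ⟨a, t, s⟩)
  · exact ⟨.inl (), rfl⟩
  · exact ⟨.inr (.inl (q, s)), rfl⟩
  · exact ⟨.inr (.inr (.inl s)), rfl⟩
  · exact ⟨.inr (.inr (.inr (.inl (q, f, w, t, s)))), rfl⟩
  · exact ⟨.inr (.inr (.inr (.inr (a, t, s)))), rfl⟩

theorem CallTape.finite : Finite (CallTape M N) := by
  have := M.finite_tape
  have := N.finite_tape
  let F : M.Tape ⊕ N.Tape ⊕ Bool → CallTape M N :=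
    Sum.elim .main <| Sum.elim .sub fun b => if b then .pos else .disp
  refine Finite.of_surjective F ?_
  rintro (i | j | _ | _)
  · exact ⟨.inl i, rfl⟩
  · exact ⟨.inr (.inl j), rfl⟩
  · exact ⟨.inr (.inr true), rfl⟩
  · exact ⟨.inr (.inr false), rfl⟩

variable {M N}

/-- Write the given components and move the heads. -/
def callAction (q : CallState M N) (mainSym : M.Tape → M.Sym)
    (subSym : N.Tape → N.Sym × Bool × Bool)
    (posSym dispSym : Bool) (mainMove : M.Tape → Move) (subMove : N.Tape → Move)
    (posMove dispMove : Move) : CallTransition M N where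
  fst := q
  snd :=
    (fun
      | .main i => (mainSym i, (N.blank, false, false), false)
      | .sub j => (M.blank, subSym j, false)
      | .pos => (M.blank, (N.blank, false, false), posSym)
      | .disp => (M.blank, (N.blank, false, false), dispSym),
    fun
      | .main i => mainMove i
      | .sub j => subMove j
      | .pos => posMove
      | .disp => dispMove)

/-- The initial action marks the cell `0` on two tapes. -/
def callInitAction (a : CallTape M N → CallSym M N) : CallTransition M N :=
  callAction (.main M.start true) (fun i => (a (.main i)).1) (fun j => (a (.sub j)).2.1) true true
    (fun _ => .stay) (fun _ => .stay) .stay .stay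

/-- The action for a transition of `M`. -/
def callMainAction (sign : Bool) (a : CallTape M N → CallSym M N)
    (t : M.State × (M.Tape → M.Sym) × (M.Tape → Move)) : CallTransition M N :=
  callAction (.main t.1 (nextSign (a .pos).2.2 (t.2.2 M.oracleTape) sign)) t.2.1
    (fun j => (a (.sub j)).2.1) (a .pos).2.2 (a .disp).2.2 t.2.2 (fun _ => .stay)
    (t.2.2 M.oracleTape) .stay

open Classical in
/-- Change the state and move only on the oracle tape. -/
noncomputable def callOracleAction (q : CallState M N) (a : CallTape M N → CallSym M N)
    (m m' : Move) :
    CallTransition M N :=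
  callAction q (fun i => (a (.main i)).1) (fun j => (a (.sub j)).2.1) (a .pos).2.2 (a .disp).2.2
    (fun i => if i = M.oracleTape then m else .stay) (fun _ => .stay) m m'

open Classical in
/-- The letter of the query under the head of the oracle tape, provided that the head has not left
the query to the right. -/
noncomputable def callLetter (word : Bool) (a : CallTape M N → CallSym M N) : Option Q :=
  if word then Function.partialInv M.query (a (.main M.oracleTape)).1 else none

open Classical in
/-- The symbol that `N` reads. -/
noncomputable def callRead (fresh : N.Tape → Option (Bool × Bool)) (word : Bool)
    (a : CallTape M N → CallSym M N) (j : N.Tape) : N.Sym :=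
  match fresh j with
  | none => (a (.sub j)).2.1.1
  | some m => if j = N.inputTape ∧ m.2 = true then
      ((callLetter word a).map N.input).getD N.blank else N.blank

/-- Whether all cells to the right of cell `0` which `N` has visited on its input tape belong to the
query. -/
noncomputable def callWord (fresh : N.Tape → Option (Bool × Bool)) (word : Bool)
    (a : CallTape M N → CallSym M N) : Bool :=
  if (fresh N.inputTape).map Prod.snd = some true then (callLetter word a).isSome else word

open Classical in
/-- The action for a transition of `N`. -/
noncomputable def callRunAction (fresh : N.Tape → Option (Bool × Bool)) (word dispSign sign : Bool)
    (a : CallTape M N → CallSym M N) (t : N.State × (N.Tape → N.Sym) × (N.Tape → Move)) :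
    CallTransition M N :=
  callAction
    (.run t.1 (fun j => nextFresh ((fresh j).getD (a (.sub j)).2.1.2) (t.2.2 j))
      (callWord fresh word a)
      (nextSign (a .disp).2.2 (t.2.2 N.inputTape).neg dispSign) sign)
    (fun i => (a (.main i)).1)
    (fun j => (t.2.1 j, remainingMarks ((fresh j).getD (a (.sub j)).2.1.2) (t.2.2 j)))
    (a .pos).2.2 (a .disp).2.2
    (fun i => if i = M.oracleTape then t.2.2 N.inputTape else .stay) t.2.2
    (t.2.2 N.inputTape) (t.2.2 N.inputTape).neg

open Classical in
/-- The transition function. -/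
noncomputable def callTrans :
    CallState M N → (CallTape M N → CallSym M N) → Set (CallTransition M N)
  | .init, a => {callInitAction a}
  | .main q sign, a =>
    if q = M.askState then {callOracleAction (.seek sign) a .stay .stay}
    else callMainAction sign a '' M.trans q fun i => (a (.main i)).1
  | .seek sign, a =>
    if (a .pos).2.2 then
      {callOracleAction (.run N.start (fun _ => some (true, true)) true sign sign) a .stay .stay}
    else {callOracleAction (.seek sign) a (Move.ofSign sign).neg (Move.ofSign sign)}
  | .run q fresh word dispSign sign, a =>
    if q ∈ N.accept ∨ N.trans q (callRead fresh word a) = ∅ then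
      {callOracleAction (.ret (decide (q ∈ N.accept)) dispSign sign) a .stay .stay}
    else callRunAction fresh word dispSign sign a '' N.trans q (callRead fresh word a)
  | .ret answer dispSign sign, a =>
    if (a .disp).2.2 then
      {callOracleAction (.main (if answer then M.yesState else M.noState) sign) a .stay .stay}
    else {callOracleAction (.ret answer dispSign sign) a (Move.ofSign dispSign)
      (Move.ofSign dispSign).neg}

variable (M N)

/-- The machine that behaves like `M` but runs `N` instead of asking the oracle. -/
noncomputable def callMachine : NTM I where
  State := CallState M N
  Sym := CallSym M N
  Tape := CallTape M N
  finite_state := CallState.finite M N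
  finite_sym := by
    have := M.finite_sym
    have := N.finite_sym
    exact inferInstance
  finite_tape := CallTape.finite M N
  start := .init
  accept := {s | ∃ q sign, s = .main q sign ∧ q ∈ M.accept}
  blank := (M.blank, (N.blank, false, false), false)
  input := ⟨fun a => (M.input a, (N.blank, false, false), false), fun a b h =>
    M.input.injective (Prod.ext_iff.1 h).1⟩
  input_ne_blank a h := M.input_ne_blank a (Prod.ext_iff.1 h).1
  inputTape := .main M.inputTape
  trans := callTrans

variable {M N}

namespace CallCfg

/-- The state. -/
noncomputable def state (b : (callMachine M N).Cfg) : CallState M N := b.state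

/-- The heads on the tapes of `M`. -/
def mainHead (b : (callMachine M N).Cfg) (i : M.Tape) : ℤ := b.head (CallTape.main i)

/-- The heads on the tapes of `N`. -/
def subHead (b : (callMachine M N).Cfg) (j : N.Tape) : ℤ := b.head (CallTape.sub j)

/-- The head on the tape that holds the position on the oracle tape. -/
def posHead (b : (callMachine M N).Cfg) : ℤ := b.head CallTape.pos

/-- The head on the tape that holds the displacement on the oracle tape. -/
def dispHead (b : (callMachine M N).Cfg) : ℤ := b.head CallTape.disp

/-- The contents of the tapes of `M`. -/
def mainCells (b : (callMachine M N).Cfg) (i : M.Tape) (z : ℤ) : M.Sym :=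
  (show CallSym M N from b.cells (CallTape.main i) z).1

/-- The contents of the tapes of `N`. -/
def subCells (b : (callMachine M N).Cfg) (j : N.Tape) (z : ℤ) : N.Sym × Bool × Bool :=
  (show CallSym M N from b.cells (CallTape.sub j) z).2.1

/-- The marks on the tape that holds the position on the oracle tape. -/
def posCells (b : (callMachine M N).Cfg) (z : ℤ) : Bool :=
  (show CallSym M N from b.cells CallTape.pos z).2.2

/-- The marks on the tape that holds the displacement on the oracle tape. -/
def dispCells (b : (callMachine M N).Cfg) (z : ℤ) : Bool :=
  (show CallSym M N from b.cells CallTape.disp z).2.2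

/-- The scanned symbols. -/
noncomputable def scan (b : (callMachine M N).Cfg) : CallTape M N → CallSym M N := b.scanned

/-- The configuration after a transition. -/
noncomputable def next (b : (callMachine M N).Cfg) (t : CallTransition M N) :
    (callMachine M N).Cfg :=
  b.apply t

variable (b : (callMachine M N).Cfg)

theorem scan_main (i : M.Tape) : (scan b (.main i)).1 = mainCells b i (mainHead b i) := rfl

theorem scan_sub (j : N.Tape) : (scan b (.sub j)).2.1 = subCells b j (subHead b j) := rfl

theorem scan_pos : (scan b .pos).2.2 = posCells b (posHead b) := rfl

theorem scan_disp : (scan b .disp).2.2 = dispCells b (dispHead b) := rfl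

variable (q : CallState M N) (mainSym : M.Tape → M.Sym) (subSym : N.Tape → N.Sym × Bool × Bool)
    (posSym dispSym : Bool) (mainMove : M.Tape → Move) (subMove : N.Tape → Move)
    (posMove dispMove : Move)

theorem mainHead_next (i : M.Tape) : mainHead (next b (callAction q mainSym subSym posSym dispSym
    mainMove subMove posMove dispMove)) i = mainHead b i + (mainMove i).toInt := rfl

theorem subHead_next (j : N.Tape) : subHead (next b (callAction q mainSym subSym posSym dispSym
    mainMove subMove posMove dispMove)) j = subHead b j + (subMove j).toInt := rfl

theorem posHead_next : posHead (next b (callAction q mainSym subSym posSym dispSym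
    mainMove subMove posMove dispMove)) = posHead b + posMove.toInt := rfl

theorem dispHead_next : dispHead (next b (callAction q mainSym subSym posSym dispSym
    mainMove subMove posMove dispMove)) = dispHead b + dispMove.toInt := rfl

theorem mainCells_next (i : M.Tape) : mainCells (next b (callAction q mainSym subSym posSym dispSym
    mainMove subMove posMove dispMove)) i =
      Function.update (mainCells b i) (mainHead b i) (mainSym i) := by
  ext z
  exact Function.apply_update (fun _ (x : CallSym M N) => x.1) (b.cells (CallTape.main i))
    (mainHead b i) (mainSym i, (N.blank, false, false), false) z

theorem subCells_next (j : N.Tape) : subCells (next b (callAction q mainSym subSym posSym dispSym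
    mainMove subMove posMove dispMove)) j =
      Function.update (subCells b j) (subHead b j) (subSym j) := by
  ext1 z
  exact Function.apply_update (fun _ (x : CallSym M N) => x.2.1) (b.cells (CallTape.sub j))
    (subHead b j) (M.blank, subSym j, false) z

theorem posCells_next : posCells (next b (callAction q mainSym subSym posSym dispSym
    mainMove subMove posMove dispMove)) =
      Function.update (posCells b) (posHead b) posSym := by
  ext1 z
  exact Function.apply_update (fun _ (x : CallSym M N) => x.2.2) (b.cells CallTape.pos)
    (posHead b) (M.blank, (N.blank, false, false), posSym) z

theorem dispCells_next : dispCells (next b (callAction q mainSym subSym posSym dispSym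
    mainMove subMove posMove dispMove)) =
      Function.update (dispCells b) (dispHead b) dispSym := by
  ext1 z
  exact Function.apply_update (fun _ (x : CallSym M N) => x.2.2) (b.cells CallTape.disp)
    (dispHead b) (M.blank, (N.blank, false, false), dispSym) z

theorem accepting_iff :
    (callMachine M N).Accepting b ↔ ∃ q sign, state b = .main q sign ∧ q ∈ M.accept := Iff.rfl

theorem step_iff_of_trans_eq {x : (callMachine M N).Cfg} (h : ¬ (callMachine M N).Accepting b)
    {t : CallTransition M N} (ht : callTrans (state b) (scan b) = {t}) :
    (callMachine M N).Step b x ↔ x = next b t :=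
  NTM.step_iff_of_trans_eq h ht

end CallCfg

end Call

/-! ### Invariants of a single oracle call -/

section Call

variable {I Q : Type} {M : OracleNTM I Q} {N : NTM Q}

open CallCfg

/-- The tapes of `M` are represented up to the position `dispHead b` on the oracle tape. -/
structure CallFrame (c : M.toNTM.Cfg) (b : (callMachine M N).Cfg) : Prop where
  main_cells : ∀ i, mainCells b i = c.cells i
  pos_cells : posCells b = fun z => decide (z = 0)
  disp_cells : dispCells b = fun z => decide (z = 0)
  main_head : ∀ i, i ≠ M.oracleTape → mainHead b i = c.head i
  pos_head : posHead b = mainHead b M.oracleTape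
  disp_head : mainHead b M.oracleTape + dispHead b = c.head M.oracleTape

/-- The effect of moving only on the oracle tape. -/
structure CallMoves (b b' : (callMachine M N).Cfg) (q : CallState M N) (m m' : ℤ) : Prop where
  state : state b' = q
  oracle : mainHead b' M.oracleTape = mainHead b M.oracleTape + m
  disp : dispHead b' = dispHead b + m'
  sub_head : subHead b' = subHead b
  sub_cells : subCells b' = subCells b

theorem callMoves_next (b : (callMachine M N).Cfg) (q : CallState M N) (m m' : Move) :
    CallMoves b (next b (callOracleAction q (scan b) m m')) q m.toInt m'.toInt where
  state := rfl
  oracle := by rw [callOracleAction, mainHead_next, if_pos rfl]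
  disp := rfl
  sub_head := by
    ext j
    rw [callOracleAction, subHead_next]
    exact add_zero _
  sub_cells := by
    ext1 j
    rw [callOracleAction, subCells_next, scan_sub, Function.update_eq_self]

/-- Opposite movements preserve the sum of position and displacement, which is the position of the
oracle head to be restored. -/
theorem CallFrame.next {c : M.toNTM.Cfg} {b : (callMachine M N).Cfg} (h : CallFrame c b)
    (q : CallState M N) {m m' : Move} (hm : m.toInt + m'.toInt = 0) :
    CallFrame c (next b (callOracleAction q (scan b) m m')) where
  main_cells i := by
    rw [callOracleAction, mainCells_next, scan_main, Function.update_eq_self, h.main_cells]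
  pos_cells := by
    rw [callOracleAction, posCells_next, scan_pos, Function.update_eq_self, h.pos_cells]
  disp_cells := by
    rw [callOracleAction, dispCells_next, scan_disp, Function.update_eq_self, h.disp_cells]
  main_head i hi := by
    rw [callOracleAction, mainHead_next, if_neg hi, h.main_head i hi]
    exact add_zero _
  pos_head := by
    rw [callOracleAction, mainHead_next, posHead_next, if_pos rfl, h.pos_head]
  disp_head := by
    rw [callOracleAction, mainHead_next, dispHead_next, if_pos rfl, ← h.disp_head]
    lia

/-- All heads are in the cells `-B, …, B`. -/
def CallSafe (B : ℕ) (b : (callMachine M N).Cfg) : Prop := ∀ i, |b.head i| ≤ B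

theorem CallFrame.safe {c : M.toNTM.Cfg} {b : (callMachine M N).Cfg} (h : CallFrame c b) {B : ℕ}
    (h₁ : ∀ i, |c.head i| ≤ B) (h₂ : |mainHead b M.oracleTape| ≤ B) (h₃ : |dispHead b| ≤ B)
    (h₄ : ∀ j, |subHead b j| ≤ B) : CallSafe B b := by
  rintro (i | j | _ | _)
  · change |mainHead b i| ≤ B
    by_cases hi : i = M.oracleTape
    · rwa [hi]
    · rw [h.main_head i hi]
      exact h₁ i
  · exact h₄ j
  · change |posHead b| ≤ B
    rwa [h.pos_head]
  · exact h₃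

/-- The machine represents the configuration `c` of `M` and is ready to simulate its next step. -/
structure CallMain (c : M.toNTM.Cfg) (sign : Bool) (b : (callMachine M N).Cfg) : Prop
    extends CallFrame c b where
  state : state b = .main c.state sign
  sign : HasSign sign (c.head M.oracleTape)
  disp : dispHead b = 0

theorem not_accepting_of_state {b : (callMachine M N).Cfg}
    (h : ∀ q sign, CallCfg.state b ≠ .main q sign) : ¬ (callMachine M N).Accepting b := by
  rw [accepting_iff]
  rintro ⟨q, s, hs, -⟩
  exact h q s hs

theorem Move.toInt_ofSign (b : Bool) : (Move.ofSign b).toInt = if b then 1 else -1 := by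
  cases b <;> rfl

/-- The machine simulates `M` with oracle `A`. -/
def CallSimulates (A : Language Q) (B : ℕ) (c : M.toNTM.Cfg) (b : (callMachine M N).Cfg) (t : ℕ) :
    Prop :=
  Simulates (M.Step A) M.toNTM.Accepting (callMachine M N).Step (callMachine M N).Accepting
    (CallSafe B) c b t

/-- Return from a call with a given answer. -/
theorem callSimulates_ret {A : Language Q} {B K n T : ℕ} {c a : M.toNTM.Cfg}
    {ans τ σ : Bool} (hK : ∀ i, |c.head i| ≤ K) (hB : K + n ≤ B)
    (hσ : HasSign σ (c.head M.oracleTape)) (u : N.Tape → ℤ) (hu : ∀ j, |u j| ≤ B)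
    (h : ∀ b', CallMain { c with state := if ans then M.yesState else M.noState } σ b' →
      subHead b' = u → CallSimulates A B a b' T) (b : (callMachine M N).Cfg)
    (hb : CallFrame c b) (hs : state b = .ret ans τ σ) (hτ : HasSign τ (dispHead b))
    (hsub : subHead b = u) (hn : |dispHead b| ≤ n) : CallSimulates A B a b (T + n + 1) := by
  have hacc : ¬ (callMachine M N).Accepting b := not_accepting_of_state (by simp [hs])
  have hsafe : CallSafe B b := by
    have := hK M.oracleTape
    have := hb.disp_head
    refine hb.safe (fun i => (hK i).trans (by lia)) ?_ (by lia) (by rwa [hsub])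
    rw [abs_le] at *
    lia
  induction n generalizing b with
  | zero =>
    have hd : dispHead b = 0 := by simpa using hn
    have hm := callMoves_next b (.main (if ans then M.yesState else M.noState) σ) .stay .stay
    refine .of_step_right hacc (fun x => step_iff_of_trans_eq b hacc (by
      rw [hs, callTrans, scan_disp, hb.disp_cells, hd]
      rfl)) hsafe (h _ ?_ (hm.sub_head.trans hsub))
    have hf := hb.next (.main (if ans then M.yesState else M.noState) σ) (m := .stay) (m' := .stay)
      rfl
    exact ⟨⟨hf.main_cells, hf.pos_cells, hf.disp_cells, hf.main_head, hf.pos_head, hf.disp_head⟩,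
      hm.state, hσ, hm.disp.trans (by rw [hd]; rfl)⟩
  | succ n ih =>
    by_cases hd : dispHead b = 0
    · exact (ih (by lia) b hb hs hτ hsub (by simp [hd]) hacc hsafe).mono (by lia)
    have hm := callMoves_next b (.ret ans τ σ) (Move.ofSign τ) (Move.ofSign τ).neg
    have hf := hb.next (.ret ans τ σ) (m := Move.ofSign τ) (m' := (Move.ofSign τ).neg)
      (by rw [Move.toInt_neg]; lia)
    have hd' := hm.disp
    rw [Move.toInt_neg, Move.toInt_ofSign] at hd'
    refine .of_step_right hacc (fun x => step_iff_of_trans_eq b hacc (by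
      rw [hs, callTrans, scan_disp, hb.disp_cells]
      simp only [hd, decide_false, Bool.false_eq_true, if_false]
      rfl)) hsafe ?_
    have hτ' : HasSign τ (dispHead (next b (callOracleAction (.ret ans τ σ) (scan b)
        (Move.ofSign τ) (Move.ofSign τ).neg))) := by
      rw [hd']
      cases τ <;> simp only [HasSign, if_true, Bool.false_eq_true, if_false] at hτ ⊢ <;> lia
    have hn' : |dispHead (next b (callOracleAction (.ret ans τ σ) (scan b)
        (Move.ofSign τ) (Move.ofSign τ).neg))| ≤ n := by
      rw [hd', abs_le]
      rw [abs_le] at hn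
      cases τ <;> simp only [HasSign, if_true, Bool.false_eq_true, if_false] at hτ ⊢ <;> lia
    have hacc' := not_accepting_of_state (b := next b (callOracleAction (.ret ans τ σ) (scan b)
        (Move.ofSign τ) (Move.ofSign τ).neg)) (by simp [hm.state])
    refine ih (by lia) _ hf hm.state hτ' (hm.sub_head.trans hsub) hn' hacc' ?_
    have h₁ := hK M.oracleTape
    have h₂ := hf.disp_head
    refine hf.safe (fun i => (hK i).trans (by lia)) ?_ (by lia) (by rwa [hm.sub_head, hsub])
    rw [abs_le] at *
    lia

/-- Move to the beginning of the query. -/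
theorem callSimulates_seek {A : Language Q} {B K n T : ℕ} {c a : M.toNTM.Cfg} {σ : Bool}
    (hK : ∀ i, |c.head i| ≤ K) (hB : 2 * K ≤ B) (hσ : HasSign σ (c.head M.oracleTape))
    (u : N.Tape → ℤ) (hu : ∀ j, |u j| ≤ B)
    (h : ∀ b', CallFrame c b' →
      state b' = .run N.start (fun _ => some (true, true)) true σ σ →
      mainHead b' M.oracleTape = 0 → subHead b' = u → CallSimulates A B a b' T)
    (b : (callMachine M N).Cfg) (hb : CallFrame c b) (hs : state b = .seek σ)
    (hsub : subHead b = u) (hsign : HasSign σ (mainHead b M.oracleTape)) (hnK : n ≤ K)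
    (hn : |mainHead b M.oracleTape| ≤ n) : CallSimulates A B a b (T + n + 1) := by
  have hacc : ¬ (callMachine M N).Accepting b := not_accepting_of_state (by simp [hs])
  -- The displacement is the difference of two positions bounded by `K`, hence the requirement `2 *
  -- K ≤ B`.
  have hsafe : CallSafe B b := by
    have := hK M.oracleTape
    have := hb.disp_head
    refine hb.safe (fun i => (hK i).trans (by lia)) (by lia) ?_ (by rwa [hsub])
    rw [abs_le] at *
    lia
  induction n generalizing b with
  | zero =>
    have hd : mainHead b M.oracleTape = 0 := by simpa using hn
    have hm := callMoves_next b (.run N.start (fun _ => some (true, true)) true σ σ) .stay .stay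
    refine .of_step_right hacc (fun x => step_iff_of_trans_eq b hacc (by
      rw [hs, callTrans, scan_pos, hb.pos_cells, hb.pos_head, hd]
      rfl)) hsafe (h _ (hb.next _ rfl) hm.state (hm.oracle.trans (by rw [hd]; rfl))
        (hm.sub_head.trans hsub))
  | succ n ih =>
    by_cases hd : mainHead b M.oracleTape = 0
    · exact (ih b hb hs hsub hsign (by lia) (by simp [hd]) hacc hsafe).mono (by lia)
    have hm := callMoves_next b (.seek σ) (Move.ofSign σ).neg (Move.ofSign σ)
    have hf := hb.next (.seek σ) (m := (Move.ofSign σ).neg) (m' := Move.ofSign σ)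
      (by rw [Move.toInt_neg]; lia)
    have hd' := hm.oracle
    rw [Move.toInt_neg, Move.toInt_ofSign] at hd'
    refine .of_step_right hacc (fun x => step_iff_of_trans_eq b hacc (by
      rw [hs, callTrans, scan_pos, hb.pos_cells, hb.pos_head]
      simp only [hd, decide_false, Bool.false_eq_true, if_false]
      rfl)) hsafe ?_
    have hacc' := not_accepting_of_state (b := next b (callOracleAction (.seek σ) (scan b)
        (Move.ofSign σ).neg (Move.ofSign σ))) (by simp [hm.state])
    have hn' : |mainHead (next b (callOracleAction (.seek σ) (scan b)
        (Move.ofSign σ).neg (Move.ofSign σ))) M.oracleTape| ≤ n := by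
      rw [hd', abs_le]
      rw [abs_le] at hn
      cases σ <;> simp only [HasSign, if_true, Bool.false_eq_true, if_false] at hsign ⊢ <;> lia
    refine ih _ hf hm.state (hm.sub_head.trans hsub) ?_ (by lia) hn' hacc' ?_
    · rw [hd']
      cases σ <;> simp only [HasSign, if_true, Bool.false_eq_true, if_false] at hsign ⊢ <;> lia
    · have h₁ := hK M.oracleTape
      have h₂ := hf.disp_head
      refine hf.safe (fun i => (hK i).trans (by lia)) (by lia) ?_ (by rwa [hm.sub_head, hsub])
      rw [abs_le] at *
      lia

/-- The machine runs `N` on the query `v`, and `nc` is the current configuration of `N`. -/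
structure CallRun (c : M.toNTM.Cfg) (v : List Q) (nc : N.Cfg) (u : N.Tape → ℤ)
    (fresh : N.Tape → Option (Bool × Bool)) (word τ σ : Bool) (lo hi : N.Tape → ℤ)
    (b : (callMachine M N).Cfg) : Prop extends CallFrame c b where
  state : state b = .run nc.state fresh word τ σ
  oracle : mainHead b M.oracleTape = nc.head N.inputTape
  sign : HasSign τ (dispHead b)
  sub_head : ∀ j, subHead b j = nc.head j + u j
  lazy : ∀ j, LazyTape ((N.initial v).cells j) (nc.cells j) (nc.head j) (subCells b j) (u j)
    (fresh j) (lo j) (hi j)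
  word : word = true ↔
    (if (fresh N.inputTape).map Prod.snd = some true then hi N.inputTape - 1
      else hi N.inputTape) < v.length

namespace CallRun

variable {c : M.toNTM.Cfg} {v : List Q} {nc : N.Cfg} {u : N.Tape → ℤ}
    {fresh : N.Tape → Option (Bool × Bool)} {word τ σ : Bool} {lo hi : N.Tape → ℤ}
    {b : (callMachine M N).Cfg}

/-- With the oracle head at 0 the displacement is the whole position to be restored, so the stored
sign `σ` is also its sign. The shift is given by where the heads of `N` currently stand. -/
theorem initial (hb : CallFrame c b)
    (hs : CallCfg.state b = .run N.start (fun _ => some (true, true)) true σ σ)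
    (h0 : mainHead b M.oracleTape = 0) (hσ : HasSign σ (c.head M.oracleTape)) :
    CallRun c v (N.initial v) (subHead b) (fun _ => some (true, true)) true σ σ 0 0 b where
  toCallFrame := hb
  state := hs
  oracle := h0
  sign := by rwa [← zero_add (dispHead b), ← h0, hb.disp_head]
  sub_head j := (zero_add _).symm
  lazy j := .initial _ _ _
  word := by simp; lia

/-- `IsQuery` says nothing about the cells beyond the one that ends the word; letters may occur
there again. The flag `word` is false as soon as the head is beyond that cell, and so hides them. -/
theorem callLetter_eq (H : CallRun c v nc u fresh word τ σ lo hi b) (hv : M.IsQuery c v)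
    (hf : (fresh N.inputTape).map Prod.snd = some true) :
    0 ≤ nc.head N.inputTape ∧ nc.head N.inputTape = hi N.inputTape ∧
      callLetter word (scan b) = v[(nc.head N.inputTape).toNat]? := by
  obtain ⟨m, hm, hm'⟩ := Option.map_eq_some_iff.1 hf
  obtain ⟨-, rfl, -⟩ := (H.lazy _).of_fresh m hm
  have hhi : nc.head N.inputTape = hi N.inputTape := by simpa using hm'
  have h0 := (H.lazy N.inputTape).hi_nonneg
  refine ⟨hhi ▸ h0, hhi, ?_⟩
  have hw := H.word
  rw [if_pos hf] at hw
  obtain ⟨n, hn⟩ := Int.eq_ofNat_of_zero_le h0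
  rw [callLetter, scan_main, H.main_cells, H.oracle, hhi, hn, Int.toNat_natCast]
  rw [hn] at hw
  obtain ⟨hv₁, hv₂⟩ := hv
  rcases lt_trichotomy n v.length with hlt | heq | hgt
  · rw [if_pos (hw.2 (by lia)), hv₁ n hlt, Function.partialInv_left M.query.injective,
      List.getElem?_eq_getElem hlt]
  · rw [if_pos (hw.2 (by lia)), List.getElem?_eq_none heq.ge, heq]
    refine Option.eq_none_iff_forall_not_mem.2 fun a ha => hv₂ a ?_
    exact ((M.query.injective.isPartialInv _ _).1 ha).symm
  · rw [if_neg (fun h => by have := hw.1 h; lia), List.getElem?_eq_none hgt.le]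

/-- While the right end is a new cell, the flag lags one cell behind. Here it catches up. -/
theorem callWord_iff (H : CallRun c v nc u fresh word τ σ lo hi b) (hv : M.IsQuery c v) :
    callWord fresh word (scan b) = true ↔ hi N.inputTape < v.length := by
  rw [callWord]
  split_ifs with hf
  · obtain ⟨h0, h1, h2⟩ := H.callLetter_eq hv hf
    rw [h2, ← h1]
    simp only [Option.isSome_iff_ne_none, ne_eq, List.getElem?_eq_none_iff]
    lia
  · rw [H.word, if_neg hf]

/-- An initialised cell stores its symbol. A new cell on the input tape is either the right end,
where the query supplies the letter, or negative by `of_fresh` and hence blank; new cells on other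
tapes are blank. -/
theorem callRead_eq (H : CallRun c v nc u fresh word τ σ lo hi b) (hv : M.IsQuery c v) :
    callRead fresh word (scan b) = nc.scanned := by
  ext1 j
  rw [callRead, NTM.Cfg.scanned]
  have hl := H.lazy j
  cases hf : fresh j with
  | none =>
    simp only
    rw [scan_sub, H.sub_head, hl.old _ hl.lo_le hl.le_hi (Or.inl hf)]
  | some m =>
    obtain ⟨h₁, h₂, h₃⟩ := hl.of_fresh m hf
    rw [h₁]
    simp only [NTM.initial]
    by_cases hj : j = N.inputTape
    · subst hj
      by_cases hm : m.2 = true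
      · obtain ⟨h0, -, h2⟩ := H.callLetter_eq hv (by rw [hf, ← hm]; rfl)
        rw [if_pos ⟨rfl, hm⟩, if_pos rfl, NTM.wordCells, if_pos h0, h2]
      · rw [if_neg (fun h => hm h.2), if_pos rfl, NTM.wordCells, if_neg]
        have : nc.head N.inputTape ≠ hi N.inputTape := by
          rintro h
          rw [h₂] at hm
          exact hm (decide_eq_true h)
        have := h₃.resolve_left this
        lia
    · rw [if_neg (fun h => hj h.1), if_neg hj]

theorem step (H : CallRun c v nc u fresh word τ σ lo hi b) (hv : M.IsQuery c v)
    (t : N.State × (N.Tape → N.Sym) × (N.Tape → Move)) :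
    ∃ fresh' word' τ' lo' hi', CallRun c v (nc.apply t) u fresh' word' τ' σ lo' hi'
      (next b (callRunAction fresh word τ σ (scan b) t)) := by
  have hmarks (j : N.Tape) : (fresh j).getD (scan b (.sub j)).2.1.2 =
      (decide (nc.head j = lo j), decide (nc.head j = hi j)) := by
    rw [scan_sub, H.sub_head]
    exact (H.lazy j).marks
  refine ⟨_, _, _, fun j => min (lo j) (nc.head j + (t.2.2 j).toInt),
    fun j => max (hi j) (nc.head j + (t.2.2 j).toInt), ⟨?_, ?_, ?_, ?_, ?_, ?_⟩, rfl, ?_, ?_, ?_,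
    fun j => ?_, ?_⟩
  · intro i
    rw [callRunAction, mainCells_next, scan_main, Function.update_eq_self, H.main_cells]
  · rw [callRunAction, posCells_next, scan_pos, Function.update_eq_self, H.pos_cells]
  · rw [callRunAction, dispCells_next, scan_disp, Function.update_eq_self, H.disp_cells]
  · intro i hi
    rw [callRunAction, mainHead_next, if_neg hi, H.main_head i hi]
    exact add_zero _
  · rw [callRunAction, mainHead_next, posHead_next, if_pos rfl, H.pos_head]
  · rw [callRunAction, mainHead_next, dispHead_next, if_pos rfl, ← H.disp_head, Move.toInt_neg]
    lia
  · rw [callRunAction, mainHead_next, if_pos rfl, H.oracle]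
    rfl
  · rw [callRunAction, dispHead_next, scan_disp, H.disp_cells]
    exact H.sign.next _
  · intro j
    rw [callRunAction, subHead_next, H.sub_head, add_right_comm]
    rfl
  · rw [callRunAction, subCells_next, hmarks, H.sub_head]
    exact (H.lazy j).step _ _
  · rw [H.callWord_iff hv, hmarks]
    have := (H.lazy N.inputTape).le_hi
    -- Only a move to the right from the right end creates a cell whose letter is not yet accounted
    -- for. There `hi` grows by one and the `- 1` in the invariant compensates.
    cases ht : t.2.2 N.inputTape
    · have : (nextFresh (decide (nc.head N.inputTape = lo N.inputTape),
        decide (nc.head N.inputTape = hi N.inputTape)) .left).map Prod.snd ≠ some true := by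
        simp only [nextFresh]
        split_ifs <;> simp
      rw [if_neg this, max_eq_left]
      simp only [Move.toInt]
      lia
    · simp only [nextFresh, Option.map_none, reduceCtorEq, if_false, Move.toInt]
      rw [max_eq_left (by lia)]
    · by_cases hh : nc.head N.inputTape = hi N.inputTape
      · rw [if_pos (by simp [nextFresh, hh])]
        simp only [Move.toInt]
        lia
      · rw [if_neg (by simp [nextFresh, hh])]
        simp only [Move.toInt]
        lia

end CallRun

/-- Run `N` and return with the answer. -/
theorem callSimulates_run {A : Language Q} {B K s T n : ℕ} {c a : M.toNTM.Cfg} {v : List Q}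
    (hN : N.Deterministic) (hv : M.IsQuery c v) (hK : ∀ i, |c.head i| ≤ K) (hB : 2 * K + s ≤ B)
    {σ : Bool} (hσ : HasSign σ (c.head M.oracleTape)) (u : N.Tape → ℤ)
    (hu : ∀ j, |u j| + s ≤ B) (nc : N.Cfg)
    (hs : ∀ x, Relation.ReflTransGen N.Step nc x → ∀ j, |x.head j| ≤ s)
    (hn : HaltsWithin N.Step nc n) {P : Prop}
    (hP : P ↔ (acceptingComputations N.Step N.Accepting nc).Nonempty)
    {fresh : N.Tape → Option (Bool × Bool)} {word τ : Bool} {lo hi : N.Tape → ℤ}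
    (b : (callMachine M N).Cfg) (hb : CallRun c v nc u fresh word τ σ lo hi b)
    (h : ∀ c' b', CallMain c' σ b' →
      (∀ [Decidable P], c' = { c with state := if P then M.yesState else M.noState }) →
      (∀ j, |subHead b' j| ≤ |u j| + s) → CallSimulates A B a b' T) :
    CallSimulates A B a b (T + (K + s) + 1 + n + 1) := by
  classical
  induction n using Nat.strong_induction_on generalizing nc fresh word τ lo hi b with
  | _ n ih =>
    have hacc : ¬ (callMachine M N).Accepting b := not_accepting_of_state (by simp [hb.state])
    have hin := hs nc .refl N.inputTape
    -- The displacement is the difference between the oracle head of `M`, within `K`, and the input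
    -- head of `N`, within `s`.
    have hdisp : |dispHead b| ≤ (K + s : ℕ) := by
      have h₁ := hK M.oracleTape
      have h₂ := hb.disp_head
      rw [hb.oracle] at h₂
      rw [abs_le] at *
      lia
    have hsub (j : N.Tape) : |subHead b j| ≤ |u j| + s := by
      rw [hb.sub_head]
      have h₁ := hs nc .refl j
      exact (abs_add_le _ _).trans (by lia)
    have hsafe : CallSafe B b :=
      hb.toCallFrame.safe (fun i => (hK i).trans (by lia)) (by rw [hb.oracle]; lia) (by lia)
        fun j => (hsub j).trans (hu j)
    -- `N` may also stop without accepting, for lack of a transition; this counts as the answer no.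
    by_cases hhalt : nc.state ∈ N.accept ∨ N.trans nc.state nc.scanned = ∅
    · have hPiff : P ↔ nc.state ∈ N.accept := by
        rw [hP]
        constructor
        · rintro ⟨l, hl⟩
          by_contra hna
          obtain ⟨x, -, ⟨-, t, ht, -⟩, -⟩ :=
            exists_of_mem_acceptingComputations (acc := N.Accepting) hna hl
          rw [hhalt.resolve_left hna] at ht
          exact ht
        · exact fun hac => ⟨[nc], .singleton, nc, rfl, hac⟩
      have hm := callMoves_next b (.ret (decide (nc.state ∈ N.accept)) τ σ) .stay .stay
      have hf := hb.toCallFrame.next (.ret (decide (nc.state ∈ N.accept)) τ σ) (m := .stay)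
        (m' := .stay) rfl
      have hd := hm.disp
      have hd' : dispHead (next b (callOracleAction (.ret (decide (nc.state ∈ N.accept)) τ σ)
          (scan b) .stay .stay)) = dispHead b := hd.trans (add_zero _)
      refine Simulates.mono (.of_step_right hacc (fun x => step_iff_of_trans_eq b hacc (by
        rw [hb.state, callTrans, hb.callRead_eq hv, if_pos hhalt])) hsafe
        (callSimulates_ret hK (n := K + s) (by lia) hσ (subHead b)
          (fun j => (hsub j).trans (hu j)) (fun b' hb' hu' => h _ b' hb' ?_ ?_) _ hf hm.state
          (by rw [hd']; exact hb.sign) hm.sub_head (by rwa [hd']))) (by lia)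
      · intro _
        simp only [decide_eq_true_eq, hPiff]
      · intro j
        rw [hu']
        exact hsub j
    · rw [not_or] at hhalt
      obtain ⟨hna, hne⟩ := hhalt
      obtain ⟨t, ht⟩ := Set.nonempty_iff_ne_empty.2 hne
      -- Here determinism is essential: the call creates no branching, and `P` passes on to the only
      -- successor.
      have htrans : N.trans nc.state nc.scanned = {t} :=
        (hN _ _).eq_singleton_of_mem ht
      have hstep : N.Step nc (nc.apply t) := ⟨hna, t, ht, rfl⟩
      obtain ⟨m, rfl, hm⟩ := hn.of_step hstep
      obtain ⟨f', w', τ', lo', hi', hb'⟩ := hb.step hv t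
      refine .of_step_right hacc (fun x => step_iff_of_trans_eq b hacc (by
        rw [hb.state, callTrans, hb.callRead_eq hv, if_neg (by simp [hna, hne]), htrans,
          Set.image_singleton])) hsafe (ih m (by lia) _
          (fun x hx => hs x (.head hstep hx)) hm ?_ _ hb')
      rw [hP]
      constructor
      · rintro ⟨l, hl⟩
        obtain ⟨x, l', ⟨-, t', ht', rfl⟩, hl', -⟩ :=
          exists_of_mem_acceptingComputations (acc := N.Accepting) hna hl
        obtain rfl : t' = t := hN _ _ ht' ht
        exact ⟨l', hl'⟩
      · rintro ⟨l, hl⟩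
        exact ⟨_, mem_acceptingComputations_cons hstep hl⟩

end Call

/-! ### Queries are unique and short -/

namespace OracleNTM

variable {I Q : Type} {M : OracleNTM I Q}

theorem IsQuery.unique {c : M.toNTM.Cfg} {v w : List Q} (hv : M.IsQuery c v) (hw : M.IsQuery c w) :
    v = w := by
  have hlen : v.length = w.length := by
    rcases lt_trichotomy v.length w.length with h | h | h
    · exact (hv.2 _ (hw.1 _ h)).elim
    · exact h
    · exact (hw.2 _ (hv.1 _ h)).elim
  refine List.ext_getElem hlen fun n h₁ h₂ => M.query.injective ?_
  rw [← hv.1 n h₁, ← hw.1 n h₂]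

/-- The word ends at the first cell without a letter. A blank is not a letter, so this is cell `k`
at the latest. -/
theorem exists_isQuery {c : M.toNTM.Cfg} {k : ℕ}
    (hk : ∀ z, (k : ℤ) ≤ |z| → c.cells M.oracleTape z = M.blank) :
    ∃ v, M.IsQuery c v ∧ v.length ≤ k := by
  classical
  have hex : ∃ n : ℕ, ∀ a, c.cells M.oracleTape n ≠ M.query a :=
    ⟨k, fun a => by rw [hk _ (by simp)]; exact (M.query_ne_blank a).symm⟩
  have hlt (i : Fin (Nat.find hex)) : ∃ a, c.cells M.oracleTape i = M.query a := by
    simpa using Nat.find_min hex i.2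
  choose f hf using hlt
  refine ⟨List.ofFn f, ⟨fun n h => ?_, fun a => ?_⟩, ?_⟩
  · rw [List.length_ofFn] at h
    rw [List.getElem_ofFn]
    exact hf ⟨n, h⟩
  · rw [List.length_ofFn]
    exact Nat.find_spec hex a
  · rw [List.length_ofFn]
    exact Nat.find_min' hex fun a => by rw [hk _ (by simp)]; exact (M.query_ne_blank a).symm

end OracleNTM

namespace NTM

variable {I : Type} {M : NTM I}

theorem initial_cells_inputTape (w : List I) :
    (M.initial w).cells M.inputTape = M.wordCells w := if_pos rfl

theorem initial_cells_of_ne (w : List I) {i : M.Tape} (hi : i ≠ M.inputTape) :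
    (M.initial w).cells i = fun _ => M.blank := if_neg hi

end NTM

/-! ### Simulation of a whole run -/

section Call

variable {I Q : Type} {M : OracleNTM I Q} {N : NTM Q}

open CallCfg

theorem callMainAction_injective (σ : Bool) (a : CallTape M N → CallSym M N) :
    Function.Injective (callMainAction σ a) := by
  rintro ⟨q, x, m⟩ ⟨q', x', m'⟩ h
  simp only [callMainAction, callAction, Prod.mk.injEq, CallState.main.injEq] at h
  obtain ⟨⟨rfl, -⟩, hx, hm⟩ := h
  obtain rfl : x = x' := funext fun i => (Prod.ext_iff.1 (congrFun hx (.main i))).1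
  obtain rfl : m = m' := funext fun i => congrFun hm (.main i)
  rfl

theorem CallMain.next {c : M.toNTM.Cfg} {σ : Bool} {b : (callMachine M N).Cfg}
    (hb : CallMain c σ b) (t : M.State × (M.Tape → M.Sym) × (M.Tape → Move)) :
    ∃ σ', CallMain (c.apply t) σ' (next b (callMainAction σ (scan b) t)) := by
  have ho : mainHead b M.oracleTape = c.head M.oracleTape := by
    rw [← hb.disp_head, hb.disp, add_zero]
  have hh (i : M.Tape) : mainHead b i = c.head i := by
    by_cases hi : i = M.oracleTape
    · rw [hi, ho]
    · exact hb.main_head i hi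
  refine ⟨_, ⟨fun i => ?_, ?_, ?_, fun i _ => ?_, ?_, ?_⟩, rfl, ?_, ?_⟩
  · rw [callMainAction, mainCells_next, hb.main_cells, hh]
    rfl
  · rw [callMainAction, posCells_next, scan_pos, Function.update_eq_self, hb.pos_cells]
  · rw [callMainAction, dispCells_next, scan_disp, Function.update_eq_self, hb.disp_cells]
  · rw [callMainAction, mainHead_next, hh]
    rfl
  · rw [callMainAction, posHead_next, mainHead_next, hb.pos_head]
  · rw [callMainAction, mainHead_next, dispHead_next, hh, hb.disp]
    exact add_zero _
  · rw [scan_pos, hb.pos_cells, hb.pos_head, ho]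
    exact hb.sign.next _
  · rw [callMainAction, dispHead_next, hb.disp]
    rfl

theorem CallMain.callTrans_eq {c : M.toNTM.Cfg} {σ : Bool} {b : (callMachine M N).Cfg}
    (hb : CallMain c σ b) (hask : c.state ≠ M.askState) :
    callTrans (CallCfg.state b) (scan b) =
      callMainAction σ (scan b) '' M.trans c.state c.scanned := by
  rw [hb.state, callTrans, if_neg hask]
  congr 2
  ext i
  rw [scan_main, hb.main_cells]
  by_cases hi : i = M.oracleTape
  · rw [hi, NTM.Cfg.scanned, ← hb.disp_head, hb.disp, add_zero]
  · rw [NTM.Cfg.scanned, hb.main_head i hi]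

/-- Induction on the remaining steps `t` of `M`, with `k` bounding those already made. Up to then
`M` has written only at distance less than `k` on the oracle tape, so queries have length at most
`K`, and each call has moved the heads on the tapes of `N` by at most `s`, which gives `k * s`. The
cost of a query is one step to enter, at most `K + 1` to reach its beginning, `T + 1` to run `N` and
`K + s + 1` to return. -/
theorem callSimulates_main {A : Language Q} {K s T : ℕ} (hN : N.Deterministic)
    (hA : N.Accepts A) (hT : ∀ v, v.length ≤ K → HaltsWithin N.Step (N.initial v) T)
    (hs : ∀ v, v.length ≤ K → ∀ x, Relation.ReflTransGen N.Step (N.initial v) x →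
      ∀ j, |x.head j| ≤ s) (t k : ℕ) (htk : k + t ≤ K) (c : M.toNTM.Cfg) (σ : Bool)
    (b : (callMachine M N).Cfg) (ht : HaltsWithin (M.Step A) c t) (hk : ∀ i, |c.head i| ≤ k)
    (hblank : ∀ z, (k : ℤ) ≤ |z| → c.cells M.oracleTape z = M.blank) (hb : CallMain c σ b)
    (hsub : ∀ j, |subHead b j| ≤ (k * s : ℕ)) :
    CallSimulates A (K * s + s + 2 * K) c b (t * (2 * K + s + T + 5)) := by
  classical
  induction t using Nat.strong_induction_on generalizing k c σ b with
  | _ t ih =>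
    have hks : k * s ≤ K * s := Nat.mul_le_mul_right _ (by lia)
    have ho : mainHead b M.oracleTape = c.head M.oracleTape := by
      rw [← hb.disp_head, hb.disp, add_zero]
    have hsafe : CallSafe (K * s + s + 2 * K) b := by
      refine hb.toCallFrame.safe (fun i => (hk i).trans (by lia)) ?_ ?_
        fun j => (hsub j).trans (by lia)
      · rw [ho]
        exact (hk _).trans (by lia)
      · rw [hb.disp, abs_zero]
        positivity
    have hacc_iff : (callMachine M N).Accepting b ↔ M.toNTM.Accepting c := by
      rw [accepting_iff, hb.state]
      simp [NTM.Accepting]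
    by_cases hacc : M.toNTM.Accepting c
    · exact .of_acc hacc (fun x => M.not_step_of_accepting A hacc) (hacc_iff.2 hacc)
        (fun x hx => hx.1 (hacc_iff.2 hacc)) hsafe
    have hacc' := mt hacc_iff.1 hacc
    by_cases hask : c.state = M.askState
    · obtain ⟨v, hv, hvk⟩ := M.exists_isQuery hblank
      have hstep (x : M.toNTM.Cfg) : M.Step A c x ↔
          x = { c with state := if v ∈ A then M.yesState else M.noState } := by
        rw [OracleNTM.Step, if_pos hask]
        constructor
        · rintro ⟨-, w, hw, rfl⟩
          rw [hv.unique hw]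
        · rintro rfl
          exact ⟨hacc, v, hv, by congr⟩
      obtain ⟨m, rfl, hm⟩ := ht.of_step ((hstep _).2 rfl)
      have hmv := callMoves_next b (.seek σ) .stay .stay
      have hf := hb.toCallFrame.next (.seek σ) (m := .stay) (m' := .stay) rfl
      have ho' := hmv.oracle.trans (add_zero _)
      have hsub' (j : N.Tape) : |subHead b j| ≤ (K * s + s + 2 * K : ℕ) :=
        (hsub j).trans (by lia)
      refine .of_step_left hacc hstep (.mono (.of_step_right hacc'
        (fun x => CallCfg.step_iff_of_trans_eq b hacc' (by
          rw [hb.state, callTrans, if_pos hask])) hsafe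
        (callSimulates_seek (K := K) (n := K) (fun i => (hk i).trans (by lia)) (by lia) hb.sign
          (subHead b) hsub' (fun b₁ hb₁ hs₁ h0 hu₁ =>
            callSimulates_run (K := K) (T := m * (2 * K + s + T + 5)) hN hv
              (fun i => (hk i).trans (by lia)) (by lia) hb.sign (subHead b₁)
              (fun j => ?_) (N.initial v) (hs v (by lia)) (hT v (by lia)) (hA v) b₁
              (.initial hb₁ hs₁ h0 hb.sign) fun c' b' hb' hc' hu' => ?_)
          _ hf hmv.state hmv.sub_head (by rw [ho', ho]; exact hb.sign) le_rfl
          (by rw [ho', ho]; exact (hk _).trans (by lia)))) ?_)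
      · have := hsub j
        rw [hu₁]
        push_cast at *
        lia
      · have hc'' : c' = { c with state := if v ∈ A then M.yesState else M.noState } := hc'
        subst hc''
        refine ih m (by lia) (k + 1) (by lia) _ σ b' hm (fun i => (hk i).trans (by lia))
          (fun z hz => hblank z (by lia)) hb' fun j => ?_
        have h₁ := hsub j
        have h₂ := hu' j
        rw [hu₁] at h₂
        rw [add_mul, one_mul]
        push_cast at *
        lia
      · rw [add_mul]
        lia
    · have htr := hb.callTrans_eq hask
      have hstep (x : M.toNTM.Cfg) : M.Step A c x ↔ M.toNTM.Step c x := by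
        rw [OracleNTM.Step, if_neg hask]
      refine .of_forall_step (ι := M.trans c.state c.scanned) (f := fun t => c.apply t.1)
        (g := fun t => next b (callMainAction σ (scan b) t.1)) hacc hacc' hsafe
        (c.apply_injective.comp Subtype.val_injective)
        ((NTM.Cfg.apply_injective b).comp
          ((callMainAction_injective σ _).comp Subtype.val_injective))
        (fun x => (hstep x).trans (NTM.step_iff hacc)) (fun x => ?_) ?_
      · rw [NTM.step_iff hacc']
        change (∃ t : callTrans (CallCfg.state b) (scan b), next b t.1 = x) ↔ _
        rw [htr]
        constructor
        · rintro ⟨⟨_, u, hu, rfl⟩, rfl⟩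
          exact ⟨⟨u, hu⟩, rfl⟩
        · rintro ⟨⟨u, hu⟩, rfl⟩
          exact ⟨⟨_, u, hu, rfl⟩, rfl⟩
      · rintro ⟨u, hu⟩
        obtain ⟨m, rfl, hm⟩ := ht.of_step ((hstep _).2 ⟨hacc, u, hu, rfl⟩)
        obtain ⟨σ', hb'⟩ := hb.next u
        refine ⟨_, ?_, ih m (by lia) (k + 1) (by lia) _ σ' _ hm
          (fun i => c.abs_head_apply_le u (hk i)) (fun z hz => ?_) hb' fun j => ?_⟩
        · rw [add_mul]
          lia
        · have := hk M.oracleTape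
          change Function.update _ (c.head M.oracleTape) _ z = _
          rw [Function.update_of_ne, hblank z (by lia)]
          rintro rfl
          push_cast at hz
          lia
        · have := hsub j
          rw [callMainAction, subHead_next, add_mul]
          simp only [Move.toInt, add_zero]
          push_cast at *
          lia

theorem callMain_initial (w : List I) :
    CallMain (M.toNTM.initial w) true
      (next ((callMachine M N).initial w) (callInitAction (scan ((callMachine M N).initial w)))) := by
  have hne {i : CallTape M N} (hi : i ≠ .main M.inputTape) (z : ℤ) :
      ((callMachine M N).initial w).cells i z = (callMachine M N).blank :=
    congrFun (NTM.initial_cells_of_ne (M := callMachine M N) w hi) z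
  refine ⟨⟨fun i => ?_, ?_, ?_, fun i _ => rfl, rfl, rfl⟩, rfl, le_rfl, rfl⟩
  · rw [callInitAction, mainCells_next, scan_main, Function.update_eq_self]
    ext z
    by_cases hi : i = M.inputTape
    · subst hi
      rw [NTM.initial_cells_inputTape]
      refine (congrArg (fun x : CallSym M N => x.1)
        (congrFun (NTM.initial_cells_inputTape (M := callMachine M N) w) z)).trans ?_
      rw [NTM.wordCells, NTM.wordCells]
      split_ifs
      · cases w[z.toNat]? <;> rfl
      · rfl
    · rw [NTM.initial_cells_of_ne w hi]
      exact congrArg (fun x : CallSym M N => x.1) (hne (by simpa using hi) z)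
  · have : posCells ((callMachine M N).initial w) = fun _ => false := funext fun z =>
      congrArg (fun x : CallSym M N => x.2.2) (hne (i := .pos) (by simp) z)
    rw [callInitAction, posCells_next, this]
    ext z
    change Function.update (fun _ => false) (0 : ℤ) true z = _
    simp [Function.update_apply]
  · have : dispCells ((callMachine M N).initial w) = fun _ => false := funext fun z =>
      congrArg (fun x : CallSym M N => x.2.2) (hne (i := .disp) (by simp) z)
    rw [callInitAction, dispCells_next, this]
    ext z
    change Function.update (fun _ => false) (0 : ℤ) true z = _
    simp [Function.update_apply]

theorem callSimulates_initial {A : Language Q} {K s T : ℕ} (hN : N.Deterministic)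
    (hA : N.Accepts A) (hT : ∀ v, v.length ≤ K → HaltsWithin N.Step (N.initial v) T)
    (hs : ∀ v, v.length ≤ K → ∀ x, Relation.ReflTransGen N.Step (N.initial v) x →
      ∀ j, |x.head j| ≤ s) (w : List I) (hw : HaltsWithin (M.Step A) (M.toNTM.initial w) K) :
    CallSimulates A (K * s + s + 2 * K) (M.toNTM.initial w) ((callMachine M N).initial w)
      (K * (2 * K + s + T + 5) + 1) := by
  have hacc : ¬ (callMachine M N).Accepting ((callMachine M N).initial w) :=
    not_accepting_of_state fun q σ (h : CallState.init = .main q σ) => nomatch h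
  refine .of_step_right hacc (fun x => CallCfg.step_iff_of_trans_eq _ hacc rfl) ?_
    (callSimulates_main hN hA hT hs K 0 (by lia) _ true _ hw (fun i => ?_) (fun z _ => ?_)
      (callMain_initial w) fun j => ?_)
  · intro i
    change |(0 : ℤ)| ≤ _
    simp
    positivity
  · simp [NTM.initial]
  · simp [NTM.initial, M.oracleTape_ne]
  · change |(0 : ℤ)| ≤ _
    simp

end Call

/-! ### The inclusion -/

/-- Over a finite alphabet there are finitely many words of length at most `K`. The bound has no
quantitative content; it serves where only halting matters, as for the count, termination and space.
-/
theorem NTM.Terminates.exists_haltsWithin {Q : Type} [Finite Q] {N : NTM Q} (hN : N.Terminates)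
    (K : ℕ) : ∃ T, ∀ v, v.length ≤ K → HaltsWithin N.Step (N.initial v) T := by
  choose t ht using hN
  obtain ⟨T, hT⟩ := ((List.finite_length_le Q K).image t).bddAbove
  exact ⟨T, fun v hv => (ht v).mono (hT ⟨v, hv, rfl⟩)⟩

theorem NTM.abs_head_le_of_reachable_initial {Q : Type} {N : NTM Q} {v : List Q} {T : ℕ}
    (h : HaltsWithin N.Step (N.initial v) T) (x : N.Cfg)
    (hx : Relation.ReflTransGen N.Step (N.initial v) x) (j : N.Tape) : |x.head j| ≤ T := by
  simpa using NTM.abs_head_le_of_haltsWithin h (k := 0) (fun i => by simp [NTM.initial]) hx j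

theorem monotone_eval (p : Polynomial ℕ) : Monotone fun n => p.eval n := by
  intro m n h
  simp only [Polynomial.eval_eq_sum_range]
  exact Finset.sum_le_sum fun i _ => Nat.mul_le_mul_left _ (Nat.pow_le_pow_left h i)

section Call

variable {I Q : Type} {M : OracleNTM I Q} {N : NTM Q} {A : Language Q}

theorem encard_acceptingRuns_callMachine [Finite Q] {p : ℕ → ℕ} (hN : N.Deterministic)
    (hterm : N.Terminates) (hA : N.Accepts A) (hM : M.TimeBounded A p) (w : List I) :
    ((callMachine M N).acceptingRuns w).encard = (M.acceptingRuns A w).encard := by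
  obtain ⟨T, hT⟩ := hterm.exists_haltsWithin (p w.length)
  obtain ⟨e⟩ := (callSimulates_initial hN hA hT
    (fun v hv => NTM.abs_head_le_of_reachable_initial (hT v hv)) w (hM w)).equiv
  exact (Set.encard_congr e).symm

theorem callMachine_terminates [Finite Q] {p : ℕ → ℕ} (hN : N.Deterministic)
    (hterm : N.Terminates) (hA : N.Accepts A) (hM : M.TimeBounded A p) :
    (callMachine M N).Terminates := by
  intro w
  obtain ⟨T, hT⟩ := hterm.exists_haltsWithin (p w.length)
  exact ⟨_, (callSimulates_initial hN hA hT
    (fun v hv => NTM.abs_head_le_of_reachable_initial (hT v hv)) w (hM w)).halts⟩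

theorem callMachine_spaceBounded [Finite Q] {p s : ℕ → ℕ} (hN : N.Deterministic)
    (hterm : N.Terminates) (hA : N.Accepts A) (hM : M.TimeBounded A p) (hs : N.SpaceBounded s)
    (hmono : Monotone s) :
    (callMachine M N).SpaceBounded fun n => p n * s (p n) + s (p n) + 2 * p n := by
  intro w c hc i
  obtain ⟨T, hT⟩ := hterm.exists_haltsWithin (p w.length)
  exact (callSimulates_initial hN hA hT
    (fun v hv x hx j => (hs v x hx j).trans (by exact_mod_cast hmono hv)) w (hM w)).safe c hc i

/-- A time bound also bounds the head positions, so `t (p n)` occurs twice: as running time and as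
space of a call. -/
theorem callMachine_timeBounded {p t : ℕ → ℕ} (hN : N.Deterministic)
    (hA : N.Accepts A) (hM : M.TimeBounded A p) (ht : N.TimeBounded t) (hmono : Monotone t) :
    (callMachine M N).TimeBounded fun n =>
      p n * (2 * p n + t (p n) + t (p n) + 5) + 1 := by
  intro w
  have hT : ∀ v : List Q, v.length ≤ p w.length → HaltsWithin N.Step (N.initial v)
      (t (p w.length)) := fun v hv => (ht v).mono (hmono hv)
  exact (callSimulates_initial hN hA hT
    (fun v hv => NTM.abs_head_le_of_reachable_initial (hT v hv)) w (hM w)).halts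

end Call

/-! ### Absorbing the overhead into the resource bounds -/

/-- In this form the overhead is a factor that, for `t` a power of two, merely adds the polynomial
`4 * K + 3` to the exponent. -/
theorem callCost_le_two_pow (K t : ℕ) (ht : 1 ≤ t) :
    K * (2 * K + t + t + 5) + 1 ≤ t * 2 ^ (4 * K + 3) := by
  have hK : K + 1 ≤ 2 ^ K := Nat.lt_two_pow_self
  have h : 8 * (K + 1) ^ 4 ≤ 2 ^ (4 * K + 3) := by
    rw [pow_add, mul_comm 4 K, pow_mul, mul_comm]
    gcongr
    norm_num
  calc K * (2 * K + t + t + 5) + 1 ≤ t * (8 * (K + 1) ^ 2) := by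
        nlinarith [Nat.mul_le_mul_right (K * K) ht, Nat.mul_le_mul_right K ht,
          Nat.zero_le (t * (K * K)), Nat.zero_le (t * K)]
    _ ≤ t * (8 * (K + 1) ^ 4) := by gcongr <;> lia
    _ ≤ _ := Nat.mul_le_mul_left _ h

theorem callSpace_le_two_pow (K s : ℕ) (hs : 1 ≤ s) :
    K * s + s + 2 * K ≤ s * 2 ^ (K + 2) := by
  have hK : K + 1 ≤ 2 ^ K := Nat.lt_two_pow_self
  rw [pow_add]
  nlinarith

theorem callMachine_bounds {I Q : Type} [Finite Q] {M : OracleNTM I Q} {N : NTM Q}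
    {A : Language Q} (C : ResourceClass) {p : Polynomial ℕ} (hN : N.Deterministic)
    (hterm : N.Terminates) (hA : N.Accepts A) (hM : M.TimeBounded A fun n => p.eval n)
    (hC : C.Bounds N) : C.Bounds (callMachine M N) := by
  cases C with
  | pspace =>
    obtain ⟨q, hq⟩ := hC
    refine ⟨p * q.comp p + q.comp p + 2 * p, ?_⟩
    simpa [Polynomial.eval_comp] using
      callMachine_spaceBounded hN hterm hA hM hq (monotone_eval q)
  | exptime =>
    obtain ⟨q, hq⟩ := hC
    refine ⟨q.comp p + (4 * p + 3), fun w => (callMachine_timeBounded hN hA hM hq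
      (fun m n h => Nat.pow_le_pow_right two_pos (monotone_eval q h)) w).mono ?_⟩
    refine (callCost_le_two_pow _ _ Nat.one_le_two_pow).trans ?_
    simp [Polynomial.eval_comp, pow_add]
  | expspace =>
    obtain ⟨q, hq⟩ := hC
    refine ⟨q.comp p + (p + 2), fun w c hc i => (callMachine_spaceBounded hN hterm hA hM hq
      (fun m n h => Nat.pow_le_pow_right two_pos (monotone_eval q h)) w c hc i).trans ?_⟩
    refine Int.ofNat_le.2 ((callSpace_le_two_pow _ _ Nat.one_le_two_pow).trans ?_)
    simp [Polynomial.eval_comp, pow_add]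
  | twoExptime =>
    obtain ⟨q, hq⟩ := hC
    refine ⟨q.comp p + (4 * p + 3), fun w => (callMachine_timeBounded hN hA hM hq
      (fun m n h => Nat.pow_le_pow_right two_pos (Nat.pow_le_pow_right two_pos
        (monotone_eval q h))) w).mono ?_⟩
    refine (callCost_le_two_pow _ _ Nat.one_le_two_pow).trans ?_
    rw [← pow_add]
    refine Nat.pow_le_pow_right two_pos ?_
    simp only [Polynomial.eval_add, Polynomial.eval_comp, Polynomial.eval_mul,
      Polynomial.eval_ofNat]
    rw [pow_add 2 (q.eval _)]
    -- With `a = 2 ^ q ≥ 1` and `b = 4 * p + 3`, `a + b ≤ a * (b + 1) ≤ a * 2 ^ b`, so the overhead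
    -- fits into the upper exponent.
    have h₁ : 4 * p.eval w.length + 3 + 1 ≤ 2 ^ (4 * p.eval w.length + 3) := Nat.lt_two_pow_self
    have h₂ : 1 ≤ 2 ^ q.eval (p.eval w.length) := Nat.one_le_two_pow
    nlinarith

theorem sharpOracle_subset_sharp (C : ResourceClass) (I : Type) :
    sharpOracle C.languages I ⊆ C.sharp I := by
  rintro f ⟨Q, _, A, M, p, ⟨N, hN, hterm, hC, hA⟩, hM, hf⟩
  exact ⟨callMachine M N, callMachine_terminates hN hterm hA hM,
    callMachine_bounds C hN hterm hA hM hC,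
    fun w => (encard_acceptingRuns_callMachine hN hterm hA hM w).trans (hf w)⟩

end CountingClasses

theorem mainTheorem5 (I : Type) [Finite I] [Nonempty I] (C : CountingClasses.ResourceClass) :
    CountingClasses.sharpOracle C.languages I ⊂ C.sharp I :=
  Set.ssubset_iff_of_subset (CountingClasses.sharpOracle_subset_sharp C I) |>.2
    ⟨_, CountingClasses.two_pow_odometerSteps_mem_sharp C,
      CountingClasses.two_pow_odometerSteps_notMem_sharpOracle _⟩
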